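/- Let $n\ge 1$, $1<p<\infty$, $0<\alpha<n/p$ and $0<q\le\infty$ (with $1/\infty=0$). For $b\in L^1_{\rm loc}(\mathbb{R}^n)$ real-valued, put $$M_{b,\alpha}f(x)=\sup_{t>0}|B(x,t)|^{-1+\frac{\alpha}{n}}\int_{B(x,t)}|b(x)-b(y)|\,|f(y)|\,dy ,\qquad \|b\|_*=\sup_{x\in\mathbb{R}^n,\,r>0}\frac1{|B(x,r)|}\int_{B(x,r)}|b(y)-b_{B(x,r)}|\,dy,$$ where $b_B=|B|^{-1}\int_B b$, and let $BMO(\mathbb{R}^n)$ be the set of $b\in L^1_{\rm loc}(\mathbb{R}^n)$ with $\|b\|_*<\infty$. Then the following are equivalent: 1. $\frac1q=\frac1p-\frac{\alpha}{n}$; 2. for every $b\in BMO(\mathbb{R}^n)$ the operator $M_{b,\alpha}$ is bounded from $L^p(\mathbb{R}^n)$ to $L^q(\mathbb{R}^n)$; 3. there is a constant $C$, independent of $b$ and $f$, such that $M_{b,\alpha}f\in L^q(\mathbb{R}^n)$ and $\|M_{b,\alpha}f\|_{L^q}\le C\,\|b\|_*\,\|f\|_{L^p}$ for all $b\in BMO(\mathbb{R}^n)$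 and all $f\in L^p(\mathbb{R}^n)$. -/

import Mathlib

open MeasureTheory
open scoped ENNReal NNReal

noncomputable section

/-- The fractional maximal commutator
`M_{b,α} f(x) = sup_{t>0} |B(x,t)|^{-1+α/n} ∫_{B(x,t)} |b(x) - b(y)| |f(y)| dy` on `ℝⁿ`,
with values in `[0,∞]`. -/
def fracMaxCommutator {n : ℕ} (b : EuclideanSpace ℝ (Fin n) → ℝ) (α : ℝ)
    (f : EuclideanSpace ℝ (Fin n) → ℝ) (x : EuclideanSpace ℝ (Fin n)) : ℝ≥0∞ :=
  ⨆ (t : ℝ) (_ : 0 < t), volume (Metric.ball x t) ^ (-1 + α / (n : ℝ)) *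
    ∫⁻ y in Metric.ball x t, ‖b x - b y‖ₑ * ‖f y‖ₑ

/-- The seminorm `‖b‖_* = sup_{x, r>0} |B(x,r)|⁻¹ ∫_{B(x,r)} |b(y) - b_{B(x,r)}| dy`,
with values in `[0,∞]`; here `b_B` is the mean value of `b` over `B`. -/
def bmoSeminorm {n : ℕ} (b : EuclideanSpace ℝ (Fin n) → ℝ) : ℝ≥0∞ :=
  ⨆ (x : EuclideanSpace ℝ (Fin n)) (r : ℝ) (_ : 0 < r),
    (volume (Metric.ball x r))⁻¹ *
      ∫⁻ y in Metric.ball x r, ‖b y - ⨍ z in Metric.ball x r, b z‖ₑ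

/-- `b ∈ BMO(ℝⁿ)`: `b` is locally integrable and `‖b‖_* < ∞`. -/
def IsBMO {n : ℕ} (b : EuclideanSpace ℝ (Fin n) → ℝ) : Prop :=
  LocallyIntegrable b volume ∧ bmoSeminorm b < ∞

/-- `T` is bounded from `L^p(ℝⁿ)` to `L^q(ℝⁿ)` with constant `A`: for every `f ∈ L^p` one has
`T f ∈ L^q` and `‖T f‖_q ≤ A ‖f‖_p`. -/
def IsLpLqBoundedWith {n : ℕ}
    (T : (EuclideanSpace ℝ (Fin n) → ℝ) → EuclideanSpace ℝ (Fin n) → ℝ≥0∞)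
    (p q A : ℝ≥0∞) : Prop :=
  ∀ f : EuclideanSpace ℝ (Fin n) → ℝ, MemLp f p volume →
    MemLp (T f) q volume ∧ eLpNorm (T f) q volume ≤ A * eLpNorm f p volume

/-- `T` is bounded from `L^p(ℝⁿ)` to `L^q(ℝⁿ)`. -/
def IsLpLqBounded {n : ℕ}
    (T : (EuclideanSpace ℝ (Fin n) → ℝ) → EuclideanSpace ℝ (Fin n) → ℝ≥0∞)
    (p q : ℝ≥0∞) : Prop :=
  ∃ A : ℝ≥0, IsLpLqBoundedWith T p q A

end

/-!
The relation between the exponents is necessary by scaling. The indicator `b` of a half-space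
through the origin is bounded, hence in BMO, and invariant under dilations. If `B` is the ball of
radius `r` about the origin and `f` is its indicator, then for every `x ∈ B` the half of `B` on
the other side of the hyperplane contributes a fixed proportion of `|B|`, so `M_{b,α} f` is at
least a multiple of `|B| ^ (α / n)` on `B` (`le_fracMaxCommutator_indicator_ball`). Comparing
norms as `r → 0` and `r → ∞` leaves only `1 / q = 1 / p - α / n`.

For sufficiency, let `‖b‖_* ≤ 1`, fix `1 < s < p` with conjugate exponent `σ`, and put
`N(x,t)` for the average of `|b x - b|^σ` and `A(x,t)` for the average of `|f|^s` over `B(x,t)`.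
Hölder's inequality, together with `A ≤ |B| ^ (-s / p) ‖f‖_p ^ s`, gives for each ball
`(|B| ^ (-1 + α / n) ∫_B |b x - b| |f|) ^ q ≤ ‖f‖_p ^ (q - p) N ^ (q / σ) A ^ (p / s)`
(`rpow_measure_mul_setLIntegral_mul_rpow_le`): under the relation between the exponents all powers
of the volume cancel. The factor `N` is not bounded, so the supremum over `t` does not reduce to
a maximal function of `f`. It is handled by a maximal inequality with weights
(`exists_lintegral_iSup_weight_mul_average_rpow_le`). For each dyadic level `2 ^ m` of `A`, Vitali's
lemma selects disjoint balls `B_j` among those on which the average is about `2 ^ m`; every ball of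
that level lies in some `5 B_j`, where it is enough to know that the supremum of the weight over
sub-balls of `5 B_j` has bounded average, while the total volume of the `B_j` is controlled by
the part of `|f|^s` above the height `2 ^ m / 2`. Summing over `m` costs a geometric series. With
the weight `1` this is the Hardy–Littlewood maximal theorem.

For the weight `N ^ (q / σ)` the required averages are bounded
(`exists_oscillation_majorant`) by the maximal theorem applied to a power of `|b - b_B|`, and by the
John–Nirenberg inequality (`exists_measure_lt_enorm_sub_setAverage_le`), which is proved on balls
from Lebesgue's differentiation theorem and the same covering lemma.
-/

/-! ### Balls: volumes, coverings, measurability of suprema of averages -/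

section Balls

open Metric Module

/-- Vitali's covering lemma for a family of open balls centred at the points of a set, one ball
for each point. -/
theorem exists_countable_disjoint_balls {X : Type*} [PseudoMetricSpace X]
    [TopologicalSpace.SeparableSpace X] (A : Set X) (t : X → ℝ)
    (ht : ∀ x ∈ A, 0 < t x) {R : ℝ} (hR : ∀ x ∈ A, t x ≤ R) :
    ∃ u ⊆ A, u.Countable ∧ (u.PairwiseDisjoint fun x => ball x (t x)) ∧
      ∀ x ∈ A, ∃ y ∈ u, ball x (t x) ⊆ ball y (5 * t y) := by
  obtain ⟨u, huA, hd, hc⟩ :=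
    Vitali.exists_disjoint_subfamily_covering_enlargement_ball A id t R hR 5 (by norm_num)
  refine ⟨u, huA, ?_, hd, hc⟩
  exact hd.countable_of_isOpen (fun _ _ => isOpen_ball)
    (fun x hx => nonempty_ball.2 (ht x (huA hx)))

/-- When `e ≤ 0`, the supremum over all radii may be taken over the rational ones: the integral is
left continuous in the radius, and the other factor is antitone. -/
theorem iSup_rpow_measure_ball_mul_lintegral_eq_rat {X : Type*} [PseudoMetricSpace X]
    [MeasurableSpace X] (μ : Measure X) {e : ℝ} (he : e ≤ 0) (x : X) (g : X → ℝ≥0∞) :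
    ⨆ (t : ℝ) (_ : 0 < t), μ (ball x t) ^ e * ∫⁻ y in ball x t, g y ∂μ =
      ⨆ (t : {t : ℚ // 0 < t}), μ (ball x (t : ℚ)) ^ e * ∫⁻ y in ball x (t : ℚ), g y ∂μ := by
  apply le_antisymm
  · refine iSup₂_le fun t ht => ?_
    have hU : ball x t = ⋃ (s : {s : ℚ // 0 < s ∧ (s : ℝ) < t}), ball x (s : ℚ) := by
      ext y
      simp only [mem_ball, Set.mem_iUnion, Subtype.exists, exists_prop]
      constructor
      · intro h
        obtain ⟨s, hs, hst⟩ := exists_rat_btwn (max_lt h ht)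
        refine ⟨s, ⟨?_, hst⟩, (le_max_left _ _).trans_lt hs⟩
        exact_mod_cast (le_max_right _ _).trans_lt hs
      · rintro ⟨s, ⟨_, hs⟩, hy⟩
        exact hy.trans hs
    have hdir : Directed (· ⊆ ·)
        (fun s : {s : ℚ // 0 < s ∧ (s : ℝ) < t} => ball x ((s : ℚ) : ℝ)) := by
      apply Monotone.directed_le
      intro a b hab
      exact ball_subset_ball (by exact_mod_cast hab)
    nth_rewrite 2 [hU]
    rw [setLIntegral_iUnion_of_directed _ hdir, ENNReal.mul_iSup]
    refine iSup_le fun s => ?_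
    refine le_trans ?_ (le_iSup _ (⟨s.1, s.2.1⟩ : {t : ℚ // 0 < t}))
    refine mul_le_mul_left ?_ _
    rw [← neg_neg e, ENNReal.rpow_neg, ENNReal.rpow_neg _ (-e)]
    exact ENNReal.inv_le_inv.2 (ENNReal.rpow_le_rpow
      (measure_mono (ball_subset_ball s.2.2.le)) (by linarith))
  · refine iSup_le fun t => ?_
    exact le_iSup₂ (f := fun (t : ℝ) (_ : 0 < t) => μ (ball x t) ^ e * ∫⁻ y in ball x t, g y ∂μ)
      ((t : ℚ) : ℝ) (by exact_mod_cast t.2)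

variable {E : Type*} [NormedAddCommGroup E] [NormedSpace ℝ E] [FiniteDimensional ℝ E]
  [MeasurableSpace E] [BorelSpace E] (μ : Measure E) [μ.IsAddHaarMeasure]

theorem measure_ball_mul_radius (x y : E) {c r : ℝ} (hc : 0 < c) :
    μ (ball x (c * r)) = ENNReal.ofReal c ^ finrank ℝ E * μ (ball y r) := by
  rw [Measure.addHaar_ball_mul_of_pos μ x hc, Measure.addHaar_ball_center μ y,
    ENNReal.ofReal_pow hc.le]

theorem measurable_iSup_rpow_measure_ball_mul_lintegral {e : ℝ} (he : e ≤ 0)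
    {k : E → E → ℝ≥0∞} (hk : Measurable (Function.uncurry k)) :
    Measurable fun x => ⨆ (t : ℝ) (_ : 0 < t),
      μ (ball x t) ^ e * ∫⁻ y in ball x t, k x y ∂μ := by
  have : SecondCountableTopology E := secondCountable_of_proper
  simp_rw [iSup_rpow_measure_ball_mul_lintegral_eq_rat μ he]
  refine Measurable.iSup fun t => ?_
  simp_rw [Measure.addHaar_ball_center μ]
  refine Measurable.const_mul ?_ _
  simp_rw [← lintegral_indicator measurableSet_ball]
  apply Measurable.lintegral_prod_right (f := fun x => (ball x ((t : ℚ) : ℝ)).indicator (k x))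
  have : (Function.uncurry fun x => (ball x ((t : ℚ) : ℝ)).indicator (k x)) =
      {z : E × E | dist z.2 z.1 < ((t : ℚ) : ℝ)}.indicator (Function.uncurry k) := by
    ext ⟨x, y⟩
    simp [Set.indicator, Function.uncurry]
  rw [this]
  exact hk.indicator (measurableSet_lt (measurable_snd.dist measurable_fst) measurable_const)

end Balls

/-! ### A weighted maximal inequality -/

section Maximal

open Metric Module

/-- A geometric series over the dyadic integers below `v`. -/
theorem exists_tsum_zpow_rpow_le {ε : ℝ} (hε : 0 < ε) : ∃ C : ℝ≥0, ∀ v : ℝ≥0∞,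
    ∑' m : ℤ, (if (2 : ℝ≥0∞) ^ m < v then ((2 : ℝ≥0∞) ^ m) ^ ε else 0) ≤ C * v ^ ε := by
  have h2 : (2 : ℝ≥0∞) ≠ 0 := by norm_num
  have h2' : (2 : ℝ≥0∞) ≠ ∞ := by norm_num
  set a : ℝ≥0∞ := ((2 : ℝ≥0∞) ^ ε)⁻¹ with ha
  have ha1 : a < 1 := by
    rw [ha, ENNReal.inv_lt_one]
    exact ENNReal.one_lt_rpow (by norm_num) hε
  have hfin : (1 - a)⁻¹ ≠ ∞ := by
    rw [ENNReal.inv_ne_top]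
    exact (tsub_pos_of_lt ha1).ne'
  refine ⟨((1 - a)⁻¹).toNNReal + 1, fun v => ?_⟩
  rcases eq_or_ne v 0 with rfl | hv
  · simp
  rcases eq_or_ne v ∞ with rfl | hv'
  · rw [ENNReal.top_rpow_of_pos hε, ENNReal.mul_top (by simp)]
    exact le_top
  obtain ⟨M, hM1, hM2⟩ := ENNReal.exists_mem_Ico_zpow hv hv' (y := 2) (by norm_num) h2'
  rw [← (Equiv.subLeft M).tsum_eq]
  have hle : ∀ k : ℤ, (if (2 : ℝ≥0∞) ^ ((Equiv.subLeft M) k) < v then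
      ((2 : ℝ≥0∞) ^ ((Equiv.subLeft M) k)) ^ ε else 0) ≤
      if 0 ≤ k then v ^ ε * a ^ k.toNat else 0 := by
    intro k
    simp only [Equiv.subLeft_apply]
    split_ifs with h1 h3 h3
    · obtain ⟨j, rfl⟩ := Int.eq_ofNat_of_zero_le h3
      have : (2 : ℝ≥0∞) ^ (M - (j : ℤ)) = 2 ^ M * ((2 : ℝ≥0∞)⁻¹) ^ j := by
        rw [sub_eq_add_neg, ENNReal.zpow_add h2 h2', ENNReal.zpow_neg, zpow_natCast,
          ENNReal.inv_pow]
      rw [this, ENNReal.mul_rpow_of_nonneg _ _ hε.le, Int.toNat_natCast]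
      gcongr
      rw [ha, ← ENNReal.inv_rpow, ← ENNReal.rpow_natCast, ← ENNReal.rpow_mul,
        ← ENNReal.rpow_natCast, ← ENNReal.rpow_mul, mul_comm]
    · exfalso
      have : (2 : ℝ≥0∞) ^ (M + 1) ≤ 2 ^ (M - k) :=
        ENNReal.zpow_le_of_le (by norm_num) (by omega)
      exact absurd (this.trans_lt h1) (not_lt.2 hM2.le)
    · exact zero_le
    · exact le_rfl
  refine (ENNReal.tsum_le_tsum hle).trans ?_
  have hinj : Function.Injective (fun j : ℕ => (j : ℤ)) := Nat.cast_injective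
  rw [← hinj.tsum_eq]
  · simp only [Nat.cast_nonneg, if_true, Int.toNat_natCast]
    rw [ENNReal.tsum_mul_left, ENNReal.tsum_geometric, mul_comm]
    gcongr
    rw [ENNReal.coe_add, ENNReal.coe_toNNReal hfin]
    exact le_self_add
  · intro k hk
    rw [Function.mem_support] at hk
    have : 0 ≤ k := by
      by_contra h
      simp [h] at hk
    exact ⟨k.toNat, by simp [this]⟩

/-- Hölder's inequality: an average over `s` is at most `(μ s) ^ (-1 / r)` times the `L^r` norm. -/
theorem inv_measure_mul_setLIntegral_le {X : Type*} [MeasurableSpace X] (μ : Measure X)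
    {r : ℝ} (hr : 1 < r) {s : Set X} (h0 : μ s ≠ 0) (h1 : μ s ≠ ∞) {u : X → ℝ≥0∞}
    (hu : Measurable u) :
    (μ s)⁻¹ * ∫⁻ y in s, u y ∂μ ≤ μ s ^ (-(1 / r)) * (∫⁻ y, u y ^ r ∂μ) ^ (1 / r) := by
  have hr0 : 0 < r := by linarith
  have hc := (Real.HolderConjugate.conjExponent hr)
  have := ENNReal.lintegral_mul_le_Lp_mul_Lq (μ.restrict s) hc hu.aemeasurable
    (aemeasurable_const (b := (1 : ℝ≥0∞)))
  simp only [Pi.mul_apply, mul_one, ENNReal.one_rpow, lintegral_one,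
    Measure.restrict_apply_univ] at this
  calc (μ s)⁻¹ * ∫⁻ y in s, u y ∂μ
      ≤ (μ s)⁻¹ * ((∫⁻ y in s, u y ^ r ∂μ) ^ (1 / r) * μ s ^ (1 / r.conjExponent)) := by gcongr
    _ = μ s ^ (-(1 / r)) * (∫⁻ y in s, u y ^ r ∂μ) ^ (1 / r) := by
      have : -(1 / r) = -1 + 1 / r.conjExponent := by
        have := hc.inv_add_inv_eq_one
        simp only [one_div]; linarith
      rw [this, ENNReal.rpow_add _ _ h0 h1, ENNReal.rpow_neg_one]
      ring
    _ ≤ _ := by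
      gcongr
      exact Measure.restrict_le_self

variable {E : Type*} [NormedAddCommGroup E] [NormedSpace ℝ E] [FiniteDimensional ℝ E]
  [MeasurableSpace E] [BorelSpace E] (μ : Measure E) [μ.IsAddHaarMeasure]

theorem exists_radius_le_of_measure_ball_le [Nontrivial E] {c : ℝ≥0∞} (hc : c ≠ ∞) :
    ∃ R : ℝ, ∀ (x : E) (t : ℝ), 0 < t → μ (ball x t) ≤ c → t ≤ R := by
  have hv0 : μ (ball (0 : E) 1) ≠ 0 := (measure_ball_pos μ _ one_pos).ne'
  refine ⟨1 + (c / μ (ball (0 : E) 1)).toReal, fun x t ht hle => ?_⟩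
  have hfin : c / μ (ball (0 : E) 1) ≠ ∞ := ENNReal.div_ne_top hc hv0
  rw [Measure.addHaar_ball_of_pos μ x ht,
    ← ENNReal.le_div_iff_mul_le (Or.inl hv0) (Or.inl measure_ball_lt_top.ne),
    ENNReal.ofReal_le_iff_le_toReal hfin] at hle
  rcases le_total t 1 with h | h
  · linarith [ENNReal.toReal_nonneg (a := c / μ (ball (0 : E) 1))]
  · have := le_self_pow₀ h (finrank_pos (R := ℝ) (M := E)).ne'
    linarith

/-- The estimate on one level of the averages of `u`. The balls `ball x (t x)`, on which `u` has
average at least `c`, are thinned out to a disjoint family by Vitali's lemma; the disjoint balls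
have total measure at most `(2 / c) ∫_{u > c / 2} u`, and `g` is controlled on each fivefold
enlargement. Since `A` need not be measurable, the bound is for a measurable superset. -/
theorem exists_measurableSet_setLIntegral_le {u g : E → ℝ≥0∞}
    (hg : Measurable g) {W : E → ℝ → ℝ≥0∞} {K : ℝ≥0∞}
    (hW : ∀ z R, 0 < R → ∃ G : E → ℝ≥0∞, Measurable G ∧
      (∀ x t, 0 < t → ball x t ⊆ ball z R → W x t ≤ G x) ∧
      ∫⁻ x in ball z R, G x ∂μ ≤ K * μ (ball z R))
    {A : Set E} {t : E → ℝ} {R : ℝ} {c D : ℝ≥0∞} (hc0 : c ≠ 0) (hc : c ≠ ∞)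
    (ht : ∀ x ∈ A, 0 < t x) (hR : ∀ x ∈ A, t x ≤ R)
    (havg : ∀ x ∈ A, c ≤ (μ (ball x (t x)))⁻¹ * ∫⁻ y in ball x (t x), u y ∂μ)
    (hle : ∀ x ∈ A, g x ≤ D * W x (t x)) :
    ∃ S : Set E, MeasurableSet S ∧ A ⊆ S ∧ ∫⁻ x in S, g x ∂μ ≤
      D * K * 5 ^ finrank ℝ E * ((2 / c) * ∫⁻ y, {y | c / 2 < u y}.indicator u y ∂μ) := by
  have : SecondCountableTopology E := secondCountable_of_proper
  obtain ⟨J, hJA, hJc, hJd, hJ⟩ := exists_countable_disjoint_balls A t ht hR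
  have : Countable J := hJc
  choose! G hGm hGW hGi using hW
  have h5 : ∀ j ∈ J, 0 < 5 * t j := fun j hj => by have := ht j (hJA hj); positivity
  -- the total measure of the disjoint balls
  have hball : ∀ j ∈ J, μ (ball j (t j)) ≤
      (2 / c) * ∫⁻ y in ball j (t j), {y | c / 2 < u y}.indicator u y ∂μ := by
    intro j hj
    have hpos : μ (ball j (t j)) ≠ 0 := (measure_ball_pos μ _ (ht j (hJA hj))).ne'
    have hfin : μ (ball j (t j)) ≠ ∞ := measure_ball_lt_top.ne
    have h1 : c * μ (ball j (t j)) ≤ ∫⁻ y in ball j (t j), u y ∂μ := by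
      have := havg j (hJA hj)
      rw [mul_comm, ← div_eq_mul_inv, ENNReal.le_div_iff_mul_le (Or.inl hpos) (Or.inl hfin)]
        at this
      exact this
    have h2 : ∫⁻ y in ball j (t j), u y ∂μ ≤
        ∫⁻ y in ball j (t j), {y | c / 2 < u y}.indicator u y ∂μ +
          c / 2 * μ (ball j (t j)) := by
      rw [← setLIntegral_const, ← lintegral_add_right _ measurable_const]
      refine lintegral_mono fun y => ?_
      by_cases hy : c / 2 < u y
      · simp [Set.indicator_of_mem (s := {y | c / 2 < u y}) (by exact hy) u]
      · simpa [Set.indicator, hy] using not_lt.1 hy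
    have h3 : c / 2 * μ (ball j (t j)) ≤
        ∫⁻ y in ball j (t j), {y | c / 2 < u y}.indicator u y ∂μ := by
      have h4 := h1.trans h2
      nth_rewrite 1 [← ENNReal.add_halves c] at h4
      rw [add_mul] at h4
      exact (ENNReal.add_le_add_iff_right
        (ENNReal.mul_ne_top (ENNReal.div_ne_top hc (by norm_num)) hfin)).1 h4
    calc μ (ball j (t j)) = (2 / c) * (c / 2 * μ (ball j (t j))) := by
          rw [← mul_assoc, ← ENNReal.inv_div (Or.inl (by norm_num)) (Or.inl (by norm_num)),
            ENNReal.inv_mul_cancel (ENNReal.div_ne_zero.2 ⟨hc0, by norm_num⟩)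
            (ENNReal.div_ne_top hc (by norm_num)), one_mul]
      _ ≤ _ := by gcongr
  have hsum : ∑' j : J, μ (ball (j : E) (t j)) ≤
      (2 / c) * ∫⁻ y, {y | c / 2 < u y}.indicator u y ∂μ := by
    calc ∑' j : J, μ (ball (j : E) (t j))
        ≤ ∑' j : J, (2 / c) *
          ∫⁻ y in ball (j : E) (t j), {y | c / 2 < u y}.indicator u y ∂μ :=
          ENNReal.tsum_le_tsum fun j => hball j j.2
      _ = (2 / c) *
          ∫⁻ y in ⋃ j ∈ J, ball (j : E) (t j), {y | c / 2 < u y}.indicator u y ∂μ := by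
          rw [ENNReal.tsum_mul_left, lintegral_biUnion hJc (fun _ _ => measurableSet_ball) hJd]
      _ ≤ _ := by
          gcongr
          exact Measure.restrict_le_self
  refine ⟨⋃ j : J, {x ∈ ball (j : E) (5 * t j) | g x ≤ D * G j (5 * t j) x}, ?_, ?_, ?_⟩
  · refine MeasurableSet.iUnion fun j => measurableSet_ball.inter ?_
    exact measurableSet_le hg ((hGm j _ (h5 j j.2)).const_mul _)
  · intro x hx
    obtain ⟨j, hj, hsub⟩ := hJ x hx
    refine Set.mem_iUnion.2 ⟨⟨j, hj⟩, hsub (mem_ball_self (ht x hx)), (hle x hx).trans ?_⟩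
    gcongr
    exact hGW j _ (h5 j hj) x (t x) (ht x hx) hsub
  · calc ∫⁻ x in ⋃ j : J, {x ∈ ball (j : E) (5 * t j) | g x ≤ D * G j (5 * t j) x}, g x ∂μ
        ≤ ∑' j : J, ∫⁻ x in {x ∈ ball (j : E) (5 * t j) | g x ≤ D * G j (5 * t j) x}, g x ∂μ :=
          lintegral_iUnion_le _ _
      _ ≤ ∑' j : J, D * K * 5 ^ finrank ℝ E * μ (ball (j : E) (t j)) := by
          refine ENNReal.tsum_le_tsum fun j => ?_
          have hGj := hGm j _ (h5 j j.2)
          calc ∫⁻ x in {x ∈ ball (j : E) (5 * t j) | g x ≤ D * G j (5 * t j) x}, g x ∂μ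
              ≤ ∫⁻ x in {x ∈ ball (j : E) (5 * t j) | g x ≤ D * G j (5 * t j) x},
                  D * G j (5 * t j) x ∂μ :=
                setLIntegral_mono (hGj.const_mul _) fun x hx => hx.2
            _ ≤ ∫⁻ x in ball (j : E) (5 * t j), D * G j (5 * t j) x ∂μ :=
                lintegral_mono_set fun x hx => hx.1
            _ = D * ∫⁻ x in ball (j : E) (5 * t j), G j (5 * t j) x ∂μ :=
                lintegral_const_mul _ hGj
            _ ≤ D * (K * μ (ball (j : E) (5 * t j))) := by
                gcongr
                exact hGi j _ (h5 j j.2)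
            _ = _ := by
                rw [measure_ball_mul_radius μ (j : E) j (by norm_num : (0 : ℝ) < 5)]
                simp only [ENNReal.ofReal_ofNat]
                ring
      _ ≤ _ := by
          rw [ENNReal.tsum_mul_left]
          gcongr

/-- To bound the integral of a supremum it suffices to treat measurable functions dominated by a
choice of members of the family. No measurability of `Φ` is needed. -/
theorem lintegral_iSup_le_of_selection {X : Type*} [MeasurableSpace X] {ν : Measure X}
    {Φ : X → ℝ → ℝ≥0∞} {C : ℝ≥0∞}
    (h : ∀ g : X → ℝ≥0∞, Measurable g → (∀ x, g x ≠ 0 → ∃ t, 0 < t ∧ g x ≤ Φ x t) →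
      ∫⁻ x, g x ∂ν ≤ C) :
    ∫⁻ x, ⨆ (t : ℝ) (_ : 0 < t), Φ x t ∂ν ≤ 2 * C := by
  rw [lintegral_eq_nnreal]
  refine iSup₂_le fun φ hφ => ?_
  rw [← SimpleFunc.lintegral_eq_lintegral]
  have hm : Measurable fun x => ((φ x : ℝ≥0) : ℝ≥0∞) := φ.measurable.coe_nnreal_ennreal
  -- half of a finite nonzero value is strictly smaller, so it is exceeded by some `Φ x t`
  have := h (fun x => (φ x : ℝ≥0∞) / 2) (hm.div_const 2) fun x hx => by
    have hx0 : (φ x : ℝ≥0∞) ≠ 0 := fun h0 => hx (by simp [h0])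
    have hlt : (φ x : ℝ≥0∞) / 2 < ⨆ (t : ℝ) (_ : 0 < t), Φ x t :=
      (ENNReal.half_lt_self hx0 ENNReal.coe_ne_top).trans_le (hφ x)
    obtain ⟨t, ht⟩ := lt_iSup_iff.1 hlt
    obtain ⟨ht0, ht⟩ := lt_iSup_iff.1 ht
    exact ⟨t, ht0, ht.le⟩
  calc ∫⁻ x, (φ.map ((↑) : ℝ≥0 → ℝ≥0∞)) x ∂ν = ∫⁻ x, 2 * ((φ x : ℝ≥0∞) / 2) ∂ν := by
        refine lintegral_congr fun x => ?_
        rw [ENNReal.mul_div_cancel (by norm_num) (by norm_num)]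
        rfl
    _ = 2 * ∫⁻ x, (φ x : ℝ≥0∞) / 2 ∂ν := lintegral_const_mul _ (hm.div_const 2)
    _ ≤ 2 * C := by gcongr

/-- A maximal inequality with weights. If the weights `W x t` with `ball x t ⊆ ball z R` are
dominated on every ball `ball z R` by a function with average at most `K`, then the maximal
function of `W` times the `r`-th power of the averages of `u` has integral at most a constant times
`K ∫ u ^ r`. The case `W = 1` is the Hardy–Littlewood maximal theorem. -/
theorem exists_lintegral_iSup_weight_mul_average_rpow_le [Nontrivial E] {r : ℝ} (hr : 1 < r) :
    ∃ C : ℝ≥0, ∀ (u : E → ℝ≥0∞) (W : E → ℝ → ℝ≥0∞) (K : ℝ≥0∞), Measurable u →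
      ∫⁻ y, u y ^ r ∂μ ≠ ∞ →
      (∀ z R, 0 < R → ∃ G : E → ℝ≥0∞, Measurable G ∧
        (∀ x t, 0 < t → ball x t ⊆ ball z R → W x t ≤ G x) ∧
        ∫⁻ x in ball z R, G x ∂μ ≤ K * μ (ball z R)) →
      ∫⁻ x, ⨆ (t : ℝ) (_ : 0 < t),
        W x t * ((μ (ball x t))⁻¹ * ∫⁻ y in ball x t, u y ∂μ) ^ r ∂μ ≤
          C * K * ∫⁻ y, u y ^ r ∂μ := by
  have hr0 : 0 < r := by linarith
  have h2 : (2 : ℝ≥0∞) ≠ 0 := by norm_num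
  have h2' : (2 : ℝ≥0∞) ≠ ∞ := by norm_num
  obtain ⟨C₁, hC₁⟩ := exists_tsum_zpow_rpow_le (sub_pos.2 hr)
  refine ⟨2 * ((5 : ℝ≥0) ^ finrank ℝ E * (2 * 2 ^ r) * C₁ * 2 ^ (r - 1)), ?_⟩
  intro u W K hu hfin hW
  set I : ℝ≥0∞ := ∫⁻ y, u y ^ r ∂μ with hI
  set d := finrank ℝ E with hd
  have key := lintegral_iSup_le_of_selection (ν := μ)
    (Φ := fun x t => W x t * ((μ (ball x t))⁻¹ * ∫⁻ y in ball x t, u y ∂μ) ^ r)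
    (C := (5 : ℝ≥0∞) ^ d * (2 * 2 ^ r) * C₁ * 2 ^ (r - 1) * K * I) ?_
  · refine key.trans (le_of_eq ?_)
    push_cast [ENNReal.coe_rpow_of_nonneg _ hr0.le,
      ENNReal.coe_rpow_of_nonneg _ (sub_pos.2 hr).le]
    ring
  intro g hg hsel
  choose! t ht0 ht using hsel
  set a : E → ℝ≥0∞ := fun x => (μ (ball x (t x)))⁻¹ * ∫⁻ y in ball x (t x), u y ∂μ with ha
  have ha_le : ∀ x, g x ≠ 0 → a x ≤ μ (ball x (t x)) ^ (-(1 / r)) * I ^ (1 / r) := fun x hx =>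
    inv_measure_mul_setLIntegral_le μ hr (measure_ball_pos μ _ (ht0 x hx)).ne'
      measure_ball_lt_top.ne hu
  have ha_top : ∀ x, g x ≠ 0 → a x ≠ ∞ := fun x hx => by
    refine ((ha_le x hx).trans_lt (ENNReal.mul_lt_top ?_ ?_)).ne
    · exact (ENNReal.rpow_ne_top_of_ne_zero (measure_ball_pos μ _ (ht0 x hx)).ne'
        measure_ball_lt_top.ne).lt_top
    · exact (ENNReal.rpow_ne_top_of_nonneg (by positivity) hfin).lt_top
  have ha0 : ∀ x, g x ≠ 0 → a x ≠ 0 := fun x hx h0 => by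
    have := ht x hx
    simp only [ha] at h0
    rw [h0, ENNReal.zero_rpow_of_pos hr0, mul_zero] at this
    exact hx (le_antisymm this zero_le)
  have hlevel : ∀ m : ℤ, ∃ S : Set E, MeasurableSet S ∧
      {x | g x ≠ 0 ∧ a x ∈ Set.Ico ((2 : ℝ≥0∞) ^ m) (2 ^ (m + 1))} ⊆ S ∧
      ∫⁻ x in S, g x ∂μ ≤ ((2 : ℝ≥0∞) ^ (m + 1)) ^ r * K * 5 ^ d *
        ((2 / 2 ^ m) * ∫⁻ y, {y | (2 : ℝ≥0∞) ^ m / 2 < u y}.indicator u y ∂μ) := by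
    intro m
    have hm0 : (2 : ℝ≥0∞) ^ m ≠ 0 := (ENNReal.zpow_pos h2 h2' m).ne'
    have hm1 : (2 : ℝ≥0∞) ^ m ≠ ∞ := (ENNReal.zpow_lt_top h2 h2' m).ne
    -- a lower bound for an average is an upper bound for the volume of the ball
    obtain ⟨R, hR⟩ := exists_radius_le_of_measure_ball_le μ
      (c := I / ((2 : ℝ≥0∞) ^ m) ^ r)
      (ENNReal.div_ne_top hfin (by simp [ENNReal.rpow_eq_zero_iff, hm0, hr0.le]))
    refine exists_measurableSet_setLIntegral_le μ hg hW (t := t) (R := R) hm0 hm1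
      (fun x hx => ht0 x hx.1) (fun x hx => hR x _ (ht0 x hx.1) ?_) (fun x hx => hx.2.1) ?_
    · have hp := (measure_ball_pos μ x (ht0 x hx.1)).ne'
      have h3 := hx.2.1.trans (ha_le x hx.1)
      rw [ENNReal.rpow_neg, ← ENNReal.div_eq_inv_mul,
        ENNReal.le_div_iff_mul_le (Or.inl (by simp [ENNReal.rpow_eq_zero_iff, hp, hr0.le]))
          (Or.inl (ENNReal.rpow_ne_top_of_nonneg (by positivity) measure_ball_lt_top.ne))] at h3
      have h4 := ENNReal.rpow_le_rpow h3 hr0.le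
      rw [ENNReal.mul_rpow_of_nonneg _ _ hr0.le, ← ENNReal.rpow_mul, ← ENNReal.rpow_mul,
        one_div_mul_cancel hr0.ne', ENNReal.rpow_one, ENNReal.rpow_one, mul_comm] at h4
      rw [ENNReal.le_div_iff_mul_le]
      · exact h4
      · exact Or.inl (by simp [ENNReal.rpow_eq_zero_iff, hm0, hr0.le])
      · exact Or.inl (ENNReal.rpow_ne_top_of_nonneg hr0.le hm1)
    · intro x hx
      refine (ht x hx.1).trans ?_
      rw [mul_comm]
      gcongr
      exact hx.2.2.le
  choose S hSm hS hSi using hlevel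
  have hcover : Set.univ ⊆ {x | g x = 0} ∪ ⋃ m, S m := by
    intro x _
    by_cases hx : g x = 0
    · exact Or.inl hx
    · obtain ⟨m, hm⟩ := ENNReal.exists_mem_Ico_zpow (ha0 x hx) (ha_top x hx)
        (y := 2) (by norm_num) h2'
      exact Or.inr (Set.mem_iUnion.2 ⟨m, hS m ⟨hx, hm⟩⟩)
  have hzero : ∫⁻ x in {x | g x = 0}, g x ∂μ = 0 := by
    have hz : MeasurableSet {x | g x = 0} := hg (measurableSet_singleton 0)
    rw [setLIntegral_congr_fun hz (g := fun _ => 0) (fun x hx => hx)]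
    simp
  have hterm : ∀ m : ℤ, ((2 : ℝ≥0∞) ^ (m + 1)) ^ r * K * 5 ^ d *
        ((2 / 2 ^ m) * ∫⁻ y, {y | (2 : ℝ≥0∞) ^ m / 2 < u y}.indicator u y ∂μ) =
      (5 : ℝ≥0∞) ^ d * (2 * 2 ^ r) * K * ∫⁻ y, u y *
        (if (2 : ℝ≥0∞) ^ m < 2 * u y then ((2 : ℝ≥0∞) ^ m) ^ (r - 1) else 0) ∂μ := by
    intro m
    have hm0 : (2 : ℝ≥0∞) ^ m ≠ 0 := (ENNReal.zpow_pos h2 h2' m).ne'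
    have hm1 : (2 : ℝ≥0∞) ^ m ≠ ∞ := (ENNReal.zpow_lt_top h2 h2' m).ne
    have h3 : ∀ y, u y *
        (if (2 : ℝ≥0∞) ^ m < 2 * u y then ((2 : ℝ≥0∞) ^ m) ^ (r - 1) else 0) =
        ((2 : ℝ≥0∞) ^ m) ^ (r - 1) * {y | (2 : ℝ≥0∞) ^ m / 2 < u y}.indicator u y := by
      intro y
      have : (2 : ℝ≥0∞) ^ m / 2 < u y ↔ (2 : ℝ≥0∞) ^ m < 2 * u y := by
        rw [ENNReal.div_lt_iff (Or.inl h2) (Or.inl h2'), mul_comm]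
      by_cases hy : (2 : ℝ≥0∞) ^ m < 2 * u y
      · simp [Set.indicator, this, mul_comm]
      · simp [Set.indicator, this, hy]
    simp_rw [h3]
    rw [lintegral_const_mul _ (hu.indicator (measurableSet_lt measurable_const hu)),
      ENNReal.zpow_add h2 h2', zpow_one, ENNReal.mul_rpow_of_nonneg _ _ hr0.le,
      ENNReal.rpow_sub _ _ hm0 hm1, ENNReal.rpow_one]
    simp only [div_eq_mul_inv]
    ring
  have hmeas : ∀ m : ℤ, Measurable fun y => u y *
      (if (2 : ℝ≥0∞) ^ m < 2 * u y then ((2 : ℝ≥0∞) ^ m) ^ (r - 1) else 0) := fun m =>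
    hu.mul (Measurable.ite (measurableSet_lt measurable_const (hu.const_mul 2))
      measurable_const measurable_const)
  calc ∫⁻ x, g x ∂μ ≤ ∫⁻ x in {x | g x = 0} ∪ ⋃ m, S m, g x ∂μ := by
        rw [← setLIntegral_univ]
        exact lintegral_mono_set hcover
    _ ≤ ∫⁻ x in {x | g x = 0}, g x ∂μ + ∫⁻ x in ⋃ m, S m, g x ∂μ := lintegral_union_le _ _ _
    _ ≤ ∑' m : ℤ, ∫⁻ x in S m, g x ∂μ := by
        rw [hzero, zero_add]
        exact lintegral_iUnion_le _ _
    _ ≤ ∑' m : ℤ, (5 : ℝ≥0∞) ^ d * (2 * 2 ^ r) * K * ∫⁻ y, u y *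
        (if (2 : ℝ≥0∞) ^ m < 2 * u y then ((2 : ℝ≥0∞) ^ m) ^ (r - 1) else 0) ∂μ :=
        ENNReal.tsum_le_tsum fun m => (hSi m).trans (hterm m).le
    _ = (5 : ℝ≥0∞) ^ d * (2 * 2 ^ r) * K * ∫⁻ y, u y * ∑' m : ℤ,
        (if (2 : ℝ≥0∞) ^ m < 2 * u y then ((2 : ℝ≥0∞) ^ m) ^ (r - 1) else 0) ∂μ := by
        rw [ENNReal.tsum_mul_left, ← lintegral_tsum fun m => (hmeas m).aemeasurable]
        simp_rw [ENNReal.tsum_mul_left]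
    _ ≤ (5 : ℝ≥0∞) ^ d * (2 * 2 ^ r) * K * ∫⁻ y, C₁ * 2 ^ (r - 1) * u y ^ r ∂μ := by
        refine mul_le_mul' le_rfl (lintegral_mono fun y => ?_)
        calc u y * _ ≤ u y * (C₁ * (2 * u y) ^ (r - 1)) := by gcongr; exact hC₁ _
          _ = C₁ * 2 ^ (r - 1) * (u y ^ (1 : ℝ) * u y ^ (r - 1)) := by
              rw [ENNReal.mul_rpow_of_nonneg _ _ (sub_pos.2 hr).le, ENNReal.rpow_one]
              ring
          _ = _ := by
              rw [← ENNReal.rpow_add_of_nonneg _ _ zero_le_one (sub_pos.2 hr).le,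
                add_sub_cancel]
    _ = _ := by
        rw [lintegral_const_mul _ (hu.pow_const r)]
        ring

/-- The Hardy–Littlewood maximal theorem for centred open balls. -/
theorem exists_lintegral_iSup_average_rpow_le [Nontrivial E] {r : ℝ} (hr : 1 < r) :
    ∃ C : ℝ≥0, ∀ u : E → ℝ≥0∞, Measurable u → ∫⁻ y, u y ^ r ∂μ ≠ ∞ →
      ∫⁻ x, (⨆ (t : ℝ) (_ : 0 < t), (μ (ball x t))⁻¹ * ∫⁻ y in ball x t, u y ∂μ) ^ r ∂μ ≤
        C * ∫⁻ y, u y ^ r ∂μ := by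
  obtain ⟨C, hC⟩ := exists_lintegral_iSup_weight_mul_average_rpow_le μ hr
  refine ⟨C, fun u hu hfin => ?_⟩
  have := hC u (fun _ _ => 1) 1 hu hfin fun z R _ =>
    ⟨fun _ => 1, measurable_const, fun _ _ _ _ => le_rfl, by simp⟩
  simp only [one_mul, mul_one] at this
  have hr0 : 0 < r := by linarith
  simpa only [← ENNReal.orderIsoRpow_apply r hr0, OrderIso.map_iSup] using this

end Maximal

/-! ### The John–Nirenberg inequality on balls -/

section JohnNirenberg

open Metric Module Filter Topology

theorem enorm_setAverage_sub_le {X : Type*} [MeasurableSpace X] {μ : Measure X} {s : Set X}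
    (h0 : μ s ≠ 0) (h1 : μ s ≠ ∞) {b : X → ℝ} (hb : IntegrableOn b s μ) (c : ℝ) :
    ‖(⨍ y in s, b y ∂μ) - c‖ₑ ≤ (μ s)⁻¹ * ∫⁻ y in s, ‖b y - c‖ₑ ∂μ := by
  have hc : IntegrableOn (fun _ => c) s μ := integrableOn_const h1
  have hr : μ.real s ≠ 0 := (ENNReal.toReal_pos h0 h1).ne'
  have : (⨍ y in s, b y ∂μ) - c = (μ.real s)⁻¹ * ∫ y in s, (b y - c) ∂μ := by
    rw [setAverage_eq, integral_sub hb hc, setIntegral_const, smul_eq_mul, smul_eq_mul, mul_sub,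
      inv_mul_cancel_left₀ hr]
  rw [this, enorm_mul]
  gcongr
  · rw [Real.enorm_eq_ofReal (by positivity), measureReal_def, ENNReal.ofReal_inv_of_pos
      (ENNReal.toReal_pos h0 h1), ENNReal.ofReal_toReal h1]
  · exact enorm_integral_le_lintegral_enorm _

theorem integrableOn_ball {X : Type*} [PseudoMetricSpace X] [ProperSpace X] [MeasurableSpace X]
    {μ : Measure X} {b : X → ℝ} (hb : LocallyIntegrable b μ) (z : X) (R : ℝ) :
    IntegrableOn b (ball z R) μ :=
  (hb.integrableOn_isCompact (isCompact_closedBall z R)).mono_set ball_subset_closedBall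

variable {E : Type*} [NormedAddCommGroup E] [NormedSpace ℝ E] [FiniteDimensional ℝ E]
  [MeasurableSpace E] [BorelSpace E] (μ : Measure E) [μ.IsAddHaarMeasure]

/-- Lebesgue's differentiation theorem along the radii `R * 5⁻¹ ^ i`. -/
theorem ae_exists_lt_average_enorm {b : E → ℝ} (hb : LocallyIntegrable b μ) (c : ℝ) {R : ℝ}
    (hR : 0 < R) (L : ℝ≥0) : ∀ᵐ x ∂μ, L < ‖b x - c‖ₑ →
      ∃ i : ℕ, L < (μ (ball x (R * 5⁻¹ ^ i)))⁻¹ *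
        ∫⁻ y in ball x (R * 5⁻¹ ^ i), ‖b y - c‖ₑ ∂μ := by
  have : SecondCountableTopology E := secondCountable_of_proper
  have : ProperSpace E := FiniteDimensional.proper_real E
  have hD : LocallyIntegrable (fun y => ‖b y - c‖) μ := fun x =>
    let ⟨s, hs, hi⟩ := hb.sub (locallyIntegrable_const c) x
    ⟨s, hs, hi.norm⟩
  filter_upwards [IsUnifLocDoublingMeasure.ae_tendsto_average μ hD 1] with x hx hlt
  have hpos : ∀ i : ℕ, 0 < R * (5⁻¹ : ℝ) ^ i := fun i => by positivity
  have hδ : Tendsto (fun i : ℕ => R * (5⁻¹ : ℝ) ^ i) atTop (𝓝[>] 0) := by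
    refine tendsto_nhdsWithin_iff.2 ⟨?_, Eventually.of_forall hpos⟩
    simpa using (tendsto_pow_atTop_nhds_zero_of_lt_one (r := (5⁻¹ : ℝ)) (by norm_num)
      (by norm_num)).const_mul R
  have ht := hx (fun _ => x) _ hδ (Eventually.of_forall fun i => by
    simpa using (hpos i).le)
  have hlt' : (L : ℝ) < ‖b x - c‖ := by
    rw [← ofReal_norm, ← ENNReal.ofReal_coe_nnreal] at hlt
    exact (ENNReal.ofReal_lt_ofReal_iff_of_nonneg L.coe_nonneg).1 hlt
  obtain ⟨i, hi⟩ := (ht.eventually (lt_mem_nhds hlt')).exists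
  refine ⟨i, ?_⟩
  have hae : ball x (R * (5⁻¹ : ℝ) ^ i) =ᵐ[μ] closedBall x (R * 5⁻¹ ^ i) := by
    refine (ae_eq_of_subset_of_measure_ge ball_subset_closedBall ?_
      measurableSet_ball.nullMeasurableSet measure_closedBall_lt_top.ne)
    rw [← ball_union_sphere]
    refine (measure_union_le _ _).trans ?_
    rw [Measure.addHaar_sphere_of_ne_zero μ x (hpos i).ne', add_zero]
  rw [← setAverage_congr hae] at hi
  have h2 := (ENNReal.ofReal_lt_ofReal_iff_of_nonneg L.coe_nonneg).2 hi
  rw [ofReal_setAverage (integrableOn_ball hD x _) (Eventually.of_forall fun y =>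
    norm_nonneg _), ENNReal.ofReal_coe_nnreal, ENNReal.div_eq_inv_mul] at h2
  simpa only [ofReal_norm] using h2

/-- If the mean oscillations of `b` are at most one, the oscillation over the doubled ball, measured
from the mean over the original ball, is still bounded by a multiple of the volume. -/
theorem setLIntegral_ball_two_mul_le {b : E → ℝ} (hb : LocallyIntegrable b μ)
    (hosc : ∀ z R, 0 < R →
      ∫⁻ y in ball z R, ‖b y - ⨍ w in ball z R, b w ∂μ‖ₑ ∂μ ≤ μ (ball z R))
    (z : E) {R : ℝ} (hR : 0 < R) :
    ∫⁻ y in ball z (2 * R), ‖b y - ⨍ w in ball z R, b w ∂μ‖ₑ ∂μ ≤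
      2 ^ finrank ℝ E * (1 + 2 ^ finrank ℝ E) * μ (ball z R) := by
  set c := ⨍ w in ball z R, b w ∂μ
  set c' := ⨍ w in ball z (2 * R), b w ∂μ
  have h2R : 0 < 2 * R := by positivity
  have hB0 : μ (ball z R) ≠ 0 := (measure_ball_pos μ z hR).ne'
  have hB1 : μ (ball z R) ≠ ∞ := measure_ball_lt_top.ne
  have hm : μ (ball z (2 * R)) = 2 ^ finrank ℝ E * μ (ball z R) := by
    rw [measure_ball_mul_radius μ z z two_pos, ENNReal.ofReal_ofNat]
  have hcc : ‖c - c'‖ₑ ≤ 2 ^ finrank ℝ E := by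
    refine (enorm_setAverage_sub_le hB0 hB1 (integrableOn_ball hb z R) c').trans ?_
    calc (μ (ball z R))⁻¹ * ∫⁻ y in ball z R, ‖b y - c'‖ₑ ∂μ
        ≤ (μ (ball z R))⁻¹ * μ (ball z (2 * R)) := by
          gcongr
          exact (lintegral_mono_set (ball_subset_ball (by linarith))).trans (hosc z _ h2R)
      _ = _ := by
          rw [hm, mul_comm, mul_assoc, ENNReal.mul_inv_cancel hB0 hB1, mul_one]
  calc ∫⁻ y in ball z (2 * R), ‖b y - c‖ₑ ∂μ
      ≤ ∫⁻ y in ball z (2 * R), (‖b y - c'‖ₑ + 2 ^ finrank ℝ E) ∂μ := by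
        refine lintegral_mono fun y => ?_
        have : b y - c = (b y - c') - (c - c') := by ring
        rw [this]
        exact enorm_sub_le.trans (by gcongr)
    _ = ∫⁻ y in ball z (2 * R), ‖b y - c'‖ₑ ∂μ +
          2 ^ finrank ℝ E * μ (ball z (2 * R)) := by
        rw [lintegral_add_right _ measurable_const, setLIntegral_const]
    _ ≤ μ (ball z (2 * R)) + 2 ^ finrank ℝ E * μ (ball z (2 * R)) := by
        gcongr
        exact hosc z _ h2R
    _ = _ := by rw [hm]; ring

/-- The John–Nirenberg inequality: if all mean oscillations of `b` are at most one, the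
distribution function of `b - b_B` on a ball `B` decays geometrically. Around almost every point
where `|b - b_B| > L` there is a largest radius in a geometric sequence at which the average of
`|b - b_B|` exceeds `L`; on the fivefold enlargement of that ball the average is still at most
`L`, so passing from `B` to it costs `L`, while Vitali's lemma selects balls of total measure a
small fraction of `μ B`. -/
theorem exists_measure_lt_enorm_sub_setAverage_le :
    ∃ L : ℝ≥0, 0 < L ∧ ∀ b : E → ℝ, LocallyIntegrable b μ →
      (∀ z R, 0 < R →
        ∫⁻ y in ball z R, ‖b y - ⨍ w in ball z R, b w ∂μ‖ₑ ∂μ ≤ μ (ball z R)) →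
      ∀ (k : ℕ) (z : E) (R : ℝ), 0 < R →
        μ {x ∈ ball z R | (k * L : ℝ≥0) < ‖b x - ⨍ w in ball z R, b w ∂μ‖ₑ} ≤
          2⁻¹ ^ k * μ (ball z R) := by
  have : SecondCountableTopology E := secondCountable_of_proper
  set d := finrank ℝ E with hd
  set M : ℝ≥0 := 2 ^ d * (1 + 2 ^ d) with hM
  have hMpos : 0 < M := by positivity
  refine ⟨2 * 5 ^ d * M, by positivity, fun b hb hosc k => ?_⟩
  set L : ℝ≥0 := 2 * 5 ^ d * M with hL
  have hML : M ≤ L := by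
    rw [hL]
    refine le_mul_of_one_le_left zero_le ?_
    exact one_le_mul one_le_two (one_le_pow₀ (by norm_num))
  induction k with
  | zero =>
    intro z R _
    rw [pow_zero, one_mul]
    exact measure_mono fun x hx => hx.1
  | succ k ih =>
    intro z R hR
    set c := ⨍ w in ball z R, b w ∂μ with hc
    have h2B := setLIntegral_ball_two_mul_le μ hb hosc z hR
    set P : E → ℕ → Prop := fun x i => L < (μ (ball x (R * 5⁻¹ ^ i)))⁻¹ *
        ∫⁻ y in ball x (R * 5⁻¹ ^ i), ‖b y - c‖ₑ ∂μ with hP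
    have hpos : ∀ i : ℕ, 0 < R * (5⁻¹ : ℝ) ^ i := fun i => by positivity
    have hP0 : ∀ x ∈ ball z R, ¬ P x 0 := by
      intro x hx
      simp only [hP, pow_zero, mul_one, not_lt]
      have hB0 : μ (ball z R) ≠ 0 := (measure_ball_pos μ z hR).ne'
      have hxz : ball x R ⊆ ball z (2 * R) :=
        ball_subset_ball' (by have := mem_ball.1 hx; linarith)
      have hxm : μ (ball x R) = μ (ball z R) := by
        rw [Measure.addHaar_ball_center, ← Measure.addHaar_ball_center μ z]
      calc (μ (ball x R))⁻¹ * ∫⁻ y in ball x R, ‖b y - c‖ₑ ∂μ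
          ≤ (μ (ball z R))⁻¹ * (2 ^ d * (1 + 2 ^ d) * μ (ball z R)) := by
            rw [hxm]
            gcongr
            exact (lintegral_mono_set hxz).trans h2B
        _ = M := by
            rw [mul_comm, mul_assoc, ENNReal.mul_inv_cancel hB0 measure_ball_lt_top.ne, mul_one,
              hM]
            push_cast
            rfl
        _ ≤ L := by exact_mod_cast hML
    set A : Set E := {x ∈ ball z R | ∃ i, P x i} with hA
    classical
    set i : E → ℕ := fun x => if h : ∃ i, P x i then Nat.find h else 0 with hi
    have hiP : ∀ x ∈ A, P x (i x) := fun x hx => by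
      simp only [hi, dif_pos hx.2]
      exact Nat.find_spec hx.2
    -- minimality of `i x` bounds the average on the enlarged ball
    have hparent : ∀ x ∈ A, (μ (ball x (5 * (R * 5⁻¹ ^ i x))))⁻¹ *
        ∫⁻ y in ball x (5 * (R * 5⁻¹ ^ i x)), ‖b y - c‖ₑ ∂μ ≤ L := by
      intro x hx
      have hne : i x ≠ 0 := fun h0 => hP0 x hx.1 (h0 ▸ hiP x hx)
      obtain ⟨j, hj⟩ := Nat.exists_eq_succ_of_ne_zero hne
      have hjP : ¬ P x j := by
        have : i x = Nat.find hx.2 := by simp only [hi, dif_pos hx.2]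
        exact Nat.find_min hx.2 (by omega)
      have : 5 * (R * (5⁻¹ : ℝ) ^ i x) = R * 5⁻¹ ^ j := by
        rw [hj, Nat.succ_eq_add_one, pow_succ]
        ring
      rw [this]
      exact not_lt.1 hjP
    have hle1 : ∀ x, R * (5⁻¹ : ℝ) ^ i x ≤ R := fun x =>
      mul_le_of_le_one_right hR.le (pow_le_one₀ (by norm_num) (by norm_num))
    obtain ⟨J, hJA, hJc, hJd, hJ⟩ := exists_countable_disjoint_balls A
      (fun x => R * 5⁻¹ ^ i x) (fun x _ => hpos _) (R := R) (fun x _ => hle1 x)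
    have : Countable J := hJc
    have hsum : L * ∑' j : J, μ (ball (j : E) (R * 5⁻¹ ^ i j)) ≤ M * μ (ball z R) := by
      calc L * ∑' j : J, μ (ball (j : E) (R * 5⁻¹ ^ i j))
          = ∑' j : J, L * μ (ball (j : E) (R * 5⁻¹ ^ i j)) := ENNReal.tsum_mul_left.symm
        _ ≤ ∑' j : J, ∫⁻ y in ball (j : E) (R * 5⁻¹ ^ i j), ‖b y - c‖ₑ ∂μ := by
            refine ENNReal.tsum_le_tsum fun j => ?_
            have := (hiP j (hJA j.2)).le
            rw [mul_comm, ← div_eq_mul_inv, ENNReal.le_div_iff_mul_le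
              (Or.inl (measure_ball_pos μ _ (hpos _)).ne') (Or.inl measure_ball_lt_top.ne)]
              at this
            exact this
        _ = ∫⁻ y in ⋃ j ∈ J, ball (j : E) (R * 5⁻¹ ^ i j), ‖b y - c‖ₑ ∂μ :=
            (lintegral_biUnion hJc (fun _ _ => measurableSet_ball) hJd _).symm
        _ ≤ ∫⁻ y in ball z (2 * R), ‖b y - c‖ₑ ∂μ := by
            refine lintegral_mono_set (Set.iUnion₂_subset fun j hj => ball_subset_ball' ?_)
            have := mem_ball.1 (hJA hj).1
            linarith [hle1 j]
        _ ≤ _ := by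
            refine h2B.trans (le_of_eq ?_)
            rw [hM]
            push_cast
            rfl
    have hcov : {x ∈ ball z R | (((k + 1 : ℕ) * L : ℝ≥0) : ℝ≥0∞) < ‖b x - c‖ₑ} ≤ᵐ[μ]
        (⋃ j : J, {x ∈ ball (j : E) (5 * (R * 5⁻¹ ^ i j)) | (k * L : ℝ≥0) <
          ‖b x - ⨍ w in ball (j : E) (5 * (R * 5⁻¹ ^ i j)), b w ∂μ‖ₑ} : Set E) := by
      filter_upwards [ae_exists_lt_average_enorm μ hb c hR L] with x hx hxS
      obtain ⟨hxB, hxlt⟩ := hxS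
      have hxA : x ∈ A := by
        refine ⟨hxB, hx (lt_of_le_of_lt ?_ hxlt)⟩
        rw [ENNReal.coe_le_coe]
        refine le_mul_of_one_le_left zero_le ?_
        exact_mod_cast Nat.le_add_left 1 k
      obtain ⟨j, hj, hsub⟩ := hJ x hxA
      refine Set.mem_iUnion.2 ⟨⟨j, hj⟩, hsub (mem_ball_self (hpos _)), ?_⟩
      have h5 : 0 < 5 * (R * (5⁻¹ : ℝ) ^ i j) := by have := hpos (i j); positivity
      have hdiff := (enorm_setAverage_sub_le (measure_ball_pos μ j h5).ne'
        measure_ball_lt_top.ne (integrableOn_ball hb j _) c).trans (hparent j (hJA hj))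
      by_contra hcon
      refine absurd hxlt (not_lt.2 ?_)
      set c' := ⨍ w in ball (j : E) (5 * (R * 5⁻¹ ^ i j)), b w ∂μ
      calc ‖b x - c‖ₑ = ‖(b x - c') + (c' - c)‖ₑ := by rw [sub_add_sub_cancel]
        _ ≤ ‖b x - c'‖ₑ + ‖c' - c‖ₑ := enorm_add_le _ _
        _ ≤ (k * L : ℝ≥0) + L := add_le_add (not_lt.1 hcon) hdiff
        _ = _ := by push_cast; ring
    calc μ {x ∈ ball z R | (((k + 1 : ℕ) * L : ℝ≥0) : ℝ≥0∞) < ‖b x - c‖ₑ}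
        ≤ ∑' j : J, μ {x ∈ ball (j : E) (5 * (R * 5⁻¹ ^ i j)) | (k * L : ℝ≥0) <
          ‖b x - ⨍ w in ball (j : E) (5 * (R * 5⁻¹ ^ i j)), b w ∂μ‖ₑ} :=
          (measure_mono_ae hcov).trans (measure_iUnion_le _)
      _ ≤ ∑' j : J, 2⁻¹ ^ k * (5 ^ d * μ (ball (j : E) (R * 5⁻¹ ^ i j))) := by
          refine ENNReal.tsum_le_tsum fun j => ?_
          have := ih j _ (mul_pos (by norm_num : (0 : ℝ) < 5) (hpos (i j)))
          rwa [measure_ball_mul_radius μ (j : E) j (by norm_num : (0 : ℝ) < 5),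
            ENNReal.ofReal_ofNat] at this
      _ = 2⁻¹ ^ k * (5 ^ d * ∑' j : J, μ (ball (j : E) (R * 5⁻¹ ^ i j))) := by
          rw [ENNReal.tsum_mul_left, ENNReal.tsum_mul_left]
      _ ≤ 2⁻¹ ^ k * (2⁻¹ * μ (ball z R)) := by
          refine mul_le_mul' le_rfl ?_
          have h1 : (M : ℝ≥0∞) ≠ 0 := by exact_mod_cast hMpos.ne'
          rw [← ENNReal.mul_le_mul_iff_right (a := 2 * M)
            (mul_ne_zero two_ne_zero h1) (ENNReal.mul_ne_top (by norm_num) ENNReal.coe_ne_top)]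
          calc 2 * (M : ℝ≥0∞) * (5 ^ d * ∑' j : J, μ (ball (j : E) (R * 5⁻¹ ^ i j)))
              = L * ∑' j : J, μ (ball (j : E) (R * 5⁻¹ ^ i j)) := by
                rw [hL]; push_cast; ring
            _ ≤ M * μ (ball z R) := hsum
            _ = 2 * M * (2⁻¹ * μ (ball z R)) := by
                rw [show 2 * (M : ℝ≥0∞) * (2⁻¹ * μ (ball z R)) =
                  (2 * 2⁻¹) * (M * μ (ball z R)) by ring,
                  ENNReal.mul_inv_cancel (by norm_num) (by norm_num), one_mul]
      _ = _ := by rw [pow_succ]; ring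

theorem summable_natCast_add_one_mul_rpow_mul_geometric (L : ℝ≥0) (σ : ℝ) :
    Summable fun k : ℕ => (((k + 1 : ℕ) * L : ℝ≥0)) ^ σ * (2⁻¹ : ℝ≥0) ^ k := by
  have h := (summable_nat_add_iff 1).2 (summable_pow_mul_geometric_of_norm_lt_one (R := ℝ)
    ⌈σ⌉₊ (r := 2⁻¹) (by norm_num))
  rw [← NNReal.summable_coe]
  refine Summable.of_nonneg_of_le (fun k => NNReal.coe_nonneg _) (fun k => ?_)
    (h.mul_left ((L : ℝ) ^ σ * 2))
  push_cast
  rw [Real.mul_rpow (by positivity) (by positivity)]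
  have h1 : ((k : ℝ) + 1) ^ σ ≤ ((k : ℝ) + 1) ^ ⌈σ⌉₊ := by
    rw [← Real.rpow_natCast]
    exact Real.rpow_le_rpow_of_exponent_le (by linarith [k.cast_nonneg (α := ℝ)])
      (Nat.le_ceil σ)
  calc ((k : ℝ) + 1) ^ σ * (L : ℝ) ^ σ * 2⁻¹ ^ k
      ≤ ((k : ℝ) + 1) ^ ⌈σ⌉₊ * (L : ℝ) ^ σ * 2⁻¹ ^ k := by gcongr
    _ = (L : ℝ) ^ σ * 2 * (((k : ℝ) + 1) ^ ⌈σ⌉₊ * 2⁻¹ ^ (k + 1)) := by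
        rw [pow_succ]; ring

/-- The integrated form of the John–Nirenberg inequality: bounded mean oscillation controls the
oscillation in every `L^σ`. -/
theorem exists_setLIntegral_enorm_sub_setAverage_rpow_le {σ : ℝ} (hσ : 0 < σ) :
    ∃ C : ℝ≥0, ∀ b : E → ℝ, Measurable b → LocallyIntegrable b μ →
      (∀ z R, 0 < R →
        ∫⁻ y in ball z R, ‖b y - ⨍ w in ball z R, b w ∂μ‖ₑ ∂μ ≤ μ (ball z R)) →
      ∀ (z : E) (R : ℝ), 0 < R →
        ∫⁻ y in ball z R, ‖b y - ⨍ w in ball z R, b w ∂μ‖ₑ ^ σ ∂μ ≤ C * μ (ball z R) := by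
  obtain ⟨L, hL, hJN⟩ := exists_measure_lt_enorm_sub_setAverage_le μ
  refine ⟨∑' k : ℕ, ((k + 1 : ℕ) * L : ℝ≥0) ^ σ * (2⁻¹ : ℝ≥0) ^ k,
    fun b hbm hb hosc z R hR => ?_⟩
  set c := ⨍ w in ball z R, b w ∂μ
  have hD : Measurable fun y => ‖b y - c‖ₑ := (hbm.sub_const c).enorm
  have hS : ∀ k : ℕ, MeasurableSet {y | (((k * L : ℝ≥0)) : ℝ≥0∞) < ‖b y - c‖ₑ} := fun k =>
    measurableSet_lt measurable_const hD
  have hpt : ∀ y, ‖b y - c‖ₑ ^ σ ≤ ∑' k : ℕ,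
      {y | (((k * L : ℝ≥0)) : ℝ≥0∞) < ‖b y - c‖ₑ}.indicator
        (fun _ => ((((k + 1 : ℕ) * L : ℝ≥0) ^ σ : ℝ≥0) : ℝ≥0∞)) y := by
    intro y
    rcases eq_or_ne (b y - c) 0 with h0 | h0
    · simp [h0, hσ]
    have hx0 : 0 < ‖b y - c‖₊ / L := div_pos (nnnorm_pos.2 h0) hL
    obtain ⟨k, hk⟩ := Nat.exists_eq_succ_of_ne_zero (Nat.ceil_pos.2 hx0).ne'
    have hlt : (k : ℝ≥0) < ‖b y - c‖₊ / L := by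
      rw [← Nat.lt_ceil, hk]
      exact Nat.lt_succ_self k
    have hle : ‖b y - c‖₊ / L ≤ (k + 1 : ℕ) := by
      rw [← Nat.succ_eq_add_one, ← hk]
      exact Nat.le_ceil _
    rw [lt_div_iff₀ hL] at hlt
    rw [div_le_iff₀ hL] at hle
    refine le_trans ?_ (ENNReal.le_tsum k)
    have hmem : y ∈ {y | (((k * L : ℝ≥0)) : ℝ≥0∞) < ‖b y - c‖ₑ} := by
      rw [Set.mem_ofPred_eq, enorm_eq_nnnorm]
      exact_mod_cast hlt
    rw [Set.indicator_of_mem hmem, ENNReal.coe_rpow_of_nonneg _ hσ.le]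
    refine ENNReal.rpow_le_rpow ?_ hσ.le
    rw [enorm_eq_nnnorm]
    exact_mod_cast hle
  calc ∫⁻ y in ball z R, ‖b y - c‖ₑ ^ σ ∂μ
      ≤ ∫⁻ y in ball z R, ∑' k : ℕ,
        {y | (((k * L : ℝ≥0)) : ℝ≥0∞) < ‖b y - c‖ₑ}.indicator
        (fun _ => ((((k + 1 : ℕ) * L : ℝ≥0) ^ σ : ℝ≥0) : ℝ≥0∞)) y ∂μ := lintegral_mono hpt
    _ = ∑' k : ℕ, ((((k + 1 : ℕ) * L : ℝ≥0) ^ σ : ℝ≥0) : ℝ≥0∞) *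
          μ {x ∈ ball z R | (k * L : ℝ≥0) < ‖b x - c‖ₑ} := by
        rw [lintegral_tsum fun k => (measurable_const.indicator (hS k)).aemeasurable]
        refine tsum_congr fun k => ?_
        rw [lintegral_indicator (hS k), setLIntegral_const, Measure.restrict_apply (hS k),
          Set.inter_comm]
        rfl
    _ ≤ ∑' k : ℕ, ((((k + 1 : ℕ) * L : ℝ≥0) ^ σ : ℝ≥0) : ℝ≥0∞) *
          (2⁻¹ ^ k * μ (ball z R)) := by
        gcongr with k
        exact hJN b hb hosc k z R hR
    _ = _ := by
        rw [ENNReal.coe_tsum (summable_natCast_add_one_mul_rpow_mul_geometric L σ),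
          ← ENNReal.tsum_mul_right]
        refine tsum_congr fun k => ?_
        rw [ENNReal.coe_mul, ENNReal.coe_pow, ENNReal.coe_inv two_ne_zero, mul_assoc]
        rfl

end JohnNirenberg

/-! ### The fractional maximal commutator with a symbol of mean oscillation at most one -/

section Commutator

open Metric Module

variable {E : Type*} [NormedAddCommGroup E] [NormedSpace ℝ E] [FiniteDimensional ℝ E]
  [MeasurableSpace E] [BorelSpace E] (μ : Measure E) [μ.IsAddHaarMeasure]

theorem ENNReal.rpow_le_one_add_rpow (y : ℝ≥0∞) {τ ρ : ℝ} (hτ : 0 ≤ τ) (h : τ ≤ ρ) :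
    y ^ τ ≤ 1 + y ^ ρ := by
  rcases le_total y 1 with hy | hy
  · exact (ENNReal.rpow_le_one hy hτ).trans le_self_add
  · exact (ENNReal.rpow_le_rpow_of_exponent_le hy h).trans le_add_self

/-- The local oscillations of `b` around the value `b x` satisfy the hypothesis on the weights in
the weighted maximal inequality: on the balls inside `B` they are controlled by `|b x - b_B|` and by
the maximal function of a power of `|b - b_B|` restricted to `B`. -/
theorem exists_oscillation_majorant [Nontrivial E] {σ τ : ℝ} (hσ : 1 ≤ σ) (hτ : 0 < τ) :
    ∃ K : ℝ≥0, ∀ b : E → ℝ, Measurable b → LocallyIntegrable b μ →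
      (∀ z R, 0 < R →
        ∫⁻ y in ball z R, ‖b y - ⨍ w in ball z R, b w ∂μ‖ₑ ∂μ ≤ μ (ball z R)) →
      ∀ z R, 0 < R → ∃ G : E → ℝ≥0∞, Measurable G ∧
        (∀ x t, 0 < t → ball x t ⊆ ball z R →
          ((μ (ball x t))⁻¹ * ∫⁻ y in ball x t, ‖b x - b y‖ₑ ^ σ ∂μ) ^ τ ≤ G x) ∧
        ∫⁻ x in ball z R, G x ∂μ ≤ K * μ (ball z R) := by
  have hσ0 : 0 < σ := by linarith
  set ρ := τ + 1 with hρ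
  have hρ1 : 1 < ρ := by linarith
  have hρ0 : 0 < ρ := by linarith
  obtain ⟨C₁, hC₁⟩ := exists_setLIntegral_enorm_sub_setAverage_rpow_le μ (mul_pos hσ0 hρ0)
  obtain ⟨C₂, hC₂⟩ := exists_lintegral_iSup_average_rpow_le μ hρ1
  set C₃ : ℝ≥0 := (2 ^ (σ - 1)) ^ ρ * 2 ^ (ρ - 1) with hC₃
  refine ⟨1 + C₃ * (C₁ + C₂ * C₁), fun b hbm hb hosc z R hR => ?_⟩
  set c := ⨍ w in ball z R, b w ∂μ
  have hD : Measurable fun y => ‖b y - c‖ₑ := (hbm.sub_const c).enorm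
  set φ : E → ℝ≥0∞ := (ball z R).indicator fun y => ‖b y - c‖ₑ ^ σ with hφ
  have hφm : Measurable φ := (hD.pow_const σ).indicator measurableSet_ball
  set Mφ : E → ℝ≥0∞ := fun x => ⨆ (t : ℝ) (_ : 0 < t),
    (μ (ball x t))⁻¹ * ∫⁻ y in ball x t, φ y ∂μ with hMφ
  have hMm : Measurable Mφ := by
    have := measurable_iSup_rpow_measure_ball_mul_lintegral μ (e := -1) (by norm_num)
      (k := fun _ y => φ y) (hφm.comp measurable_snd)
    simpa only [ENNReal.rpow_neg_one] using this
  have hφρ : ∫⁻ y, φ y ^ ρ ∂μ ≤ C₁ * μ (ball z R) := by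
    refine le_trans (le_of_eq ?_) (hC₁ b hbm hb hosc z R hR)
    rw [← lintegral_indicator measurableSet_ball]
    refine lintegral_congr fun y => ?_
    by_cases hy : y ∈ ball z R
    · simp only [hφ, Set.indicator_of_mem hy, ENNReal.rpow_mul]
      rfl
    · simp only [hφ, Set.indicator_of_notMem hy, ENNReal.zero_rpow_of_pos hρ0]
  refine ⟨fun x => 1 + C₃ * (‖b x - c‖ₑ ^ (σ * ρ) + Mφ x ^ ρ), ?_, ?_, ?_⟩
  · exact measurable_const.add (((hD.pow_const _).add (hMm.pow_const _)).const_mul _)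
  · intro x t ht hsub
    have hB0 : μ (ball x t) ≠ 0 := (measure_ball_pos μ x ht).ne'
    have hB1 : μ (ball x t) ≠ ∞ := measure_ball_lt_top.ne
    have h1 : (μ (ball x t))⁻¹ * ∫⁻ y in ball x t, ‖b x - b y‖ₑ ^ σ ∂μ ≤
        2 ^ (σ - 1) * (‖b x - c‖ₑ ^ σ + Mφ x) := by
      have hm : Measurable fun y => ‖b x - c‖ₑ ^ σ + φ y := measurable_const.add hφm
      calc (μ (ball x t))⁻¹ * ∫⁻ y in ball x t, ‖b x - b y‖ₑ ^ σ ∂μ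
          ≤ (μ (ball x t))⁻¹ * ∫⁻ y in ball x t,
              2 ^ (σ - 1) * (‖b x - c‖ₑ ^ σ + φ y) ∂μ := by
            refine mul_le_mul' le_rfl (setLIntegral_mono (hm.const_mul _) fun y hy => ?_)
            simp only [hφ, Set.indicator_of_mem (hsub hy)]
            refine le_trans ?_ (ENNReal.rpow_add_le_mul_rpow_add_rpow _ _ hσ)
            refine ENNReal.rpow_le_rpow ?_ hσ0.le
            rw [← sub_sub_sub_cancel_right (b x) (b y) c]
            exact enorm_sub_le
        _ = 2 ^ (σ - 1) * (‖b x - c‖ₑ ^ σ * (μ (ball x t) * (μ (ball x t))⁻¹) +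
              (μ (ball x t))⁻¹ * ∫⁻ y in ball x t, φ y ∂μ) := by
            rw [lintegral_const_mul _ hm,
              lintegral_add_left measurable_const, setLIntegral_const]
            ring
        _ ≤ _ := by
            rw [ENNReal.mul_inv_cancel hB0 hB1, mul_one]
            gcongr
            exact le_iSup₂ (f := fun (t : ℝ) (_ : 0 < t) =>
              (μ (ball x t))⁻¹ * ∫⁻ y in ball x t, φ y ∂μ) t ht
    refine (ENNReal.rpow_le_one_add_rpow _ hτ.le (by linarith : τ ≤ ρ)).trans ?_
    refine add_le_add le_rfl ?_
    calc ((μ (ball x t))⁻¹ * ∫⁻ y in ball x t, ‖b x - b y‖ₑ ^ σ ∂μ) ^ ρ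
        ≤ (2 ^ (σ - 1) * (‖b x - c‖ₑ ^ σ + Mφ x)) ^ ρ := by gcongr
      _ ≤ (2 ^ (σ - 1)) ^ ρ * (2 ^ (ρ - 1) * ((‖b x - c‖ₑ ^ σ) ^ ρ + Mφ x ^ ρ)) := by
          rw [ENNReal.mul_rpow_of_nonneg _ _ hρ0.le]
          gcongr
          exact ENNReal.rpow_add_le_mul_rpow_add_rpow _ _ hρ1.le
      _ = _ := by
          rw [← ENNReal.rpow_mul ‖b x - c‖ₑ, hC₃]
          push_cast [ENNReal.coe_rpow_of_nonneg _ hρ0.le,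
            ENNReal.coe_rpow_of_nonneg _ (sub_nonneg.2 hσ),
            ENNReal.coe_rpow_of_nonneg _ (sub_nonneg.2 hρ1.le)]
          ring
  · have hHL : ∫⁻ x in ball z R, Mφ x ^ ρ ∂μ ≤ C₂ * (C₁ * μ (ball z R)) := by
      refine (setLIntegral_le_lintegral _ _).trans ((hC₂ φ hφm ?_).trans ?_)
      · exact (hφρ.trans_lt (ENNReal.mul_lt_top ENNReal.coe_lt_top measure_ball_lt_top)).ne
      · gcongr
    have hm : Measurable fun x => ‖b x - c‖ₑ ^ (σ * ρ) + Mφ x ^ ρ :=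
      (hD.pow_const _).add (hMm.pow_const _)
    calc ∫⁻ x in ball z R, (1 + C₃ * (‖b x - c‖ₑ ^ (σ * ρ) + Mφ x ^ ρ)) ∂μ
        = μ (ball z R) + C₃ * (∫⁻ x in ball z R, ‖b x - c‖ₑ ^ (σ * ρ) ∂μ +
            ∫⁻ x in ball z R, Mφ x ^ ρ ∂μ) := by
          rw [lintegral_add_left measurable_const, setLIntegral_const, one_mul,
            lintegral_const_mul _ hm,
            lintegral_add_left (hD.pow_const _)]
      _ ≤ μ (ball z R) + C₃ * (C₁ * μ (ball z R) + C₂ * (C₁ * μ (ball z R))) := by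
          gcongr
          exact hC₁ b hbm hb hosc z R hR
      _ = _ := by push_cast; ring

/-- Hölder's inequality on one ball. The exponents are those of the strong type bound: `s` and `σ`
are conjugate and `a = 1 / p - 1 / q`. All powers of the volume of the ball cancel. -/
theorem rpow_measure_mul_setLIntegral_mul_rpow_le {X : Type*} [MeasurableSpace X]
    {ν : Measure X} {p q s σ a : ℝ} (hs : s.HolderConjugate σ) (hsp : s < p) (hpq : p < q)
    (ha : q⁻¹ = p⁻¹ - a) {B : Set X} (h0 : ν B ≠ 0) (h1 : ν B ≠ ∞) {h f : X → ℝ≥0∞}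
    (hh : Measurable h) (hf : Measurable f) :
    (ν B ^ (-1 + a) * ∫⁻ y in B, h y * f y ∂ν) ^ q ≤
      (∫⁻ y, f y ^ p ∂ν) ^ ((q - p) / p) * (((ν B)⁻¹ * ∫⁻ y in B, h y ^ σ ∂ν) ^ (q / σ) *
        ((ν B)⁻¹ * ∫⁻ y in B, f y ^ s ∂ν) ^ (p / s)) := by
  have hs0 : 0 < s := hs.pos
  have hσ0 : 0 < σ := hs.symm.pos
  have hp0 : 0 < p := hs0.trans hsp
  have hq0 : 0 < q := hp0.trans hpq
  have hr : 1 < p / s := (one_lt_div hs0).2 hsp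
  set V := ν B with hV
  set N := V⁻¹ * ∫⁻ y in B, h y ^ σ ∂ν with hN
  set A := V⁻¹ * ∫⁻ y in B, f y ^ s ∂ν with hA
  set I := ∫⁻ y, f y ^ p ∂ν with hI
  have hVN : ∫⁻ y in B, h y ^ σ ∂ν = V * N := by
    rw [hN, ← mul_assoc, ENNReal.mul_inv_cancel h0 h1, one_mul]
  have hVA : ∫⁻ y in B, f y ^ s ∂ν = V * A := by
    rw [hA, ← mul_assoc, ENNReal.mul_inv_cancel h0 h1, one_mul]
  have hconj : 1 / σ + 1 / s = 1 := by
    have := hs.inv_add_inv_eq_one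
    rw [one_div, one_div]
    linarith
  have hol : ∫⁻ y in B, h y * f y ∂ν ≤ V * (N ^ (1 / σ) * A ^ (1 / s)) := by
    refine (ENNReal.lintegral_mul_le_Lp_mul_Lq (ν.restrict B) hs.symm hh.aemeasurable
      hf.aemeasurable).trans (le_of_eq ?_)
    rw [hVN, hVA, ENNReal.mul_rpow_of_nonneg V N (by positivity),
      ENNReal.mul_rpow_of_nonneg V A (by positivity),
      show V * (N ^ (1 / σ) * A ^ (1 / s)) = V ^ (1 / σ + 1 / s) * (N ^ (1 / σ) * A ^ (1 / s)) by
        rw [hconj, ENNReal.rpow_one], ENNReal.rpow_add _ _ h0 h1]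
    ring
  have hAle : A ≤ V ^ (-(1 / (p / s))) * I ^ (1 / (p / s)) := by
    have := inv_measure_mul_setLIntegral_le ν hr h0 h1 (hf.pow_const s)
    simpa only [← ENNReal.rpow_mul, mul_div_cancel₀ p hs0.ne'] using this
  have haq : a * q = (q - p) / p := by
    have : a = p⁻¹ - q⁻¹ := by linarith
    rw [this]
    field_simp
  have hqp : 0 ≤ (q - p) / s := div_nonneg (by linarith) hs0.le
  have hAqp : A ^ ((q - p) / s) ≤ V ^ (-(a * q)) * I ^ ((q - p) / p) := by
    refine (ENNReal.rpow_le_rpow hAle hqp).trans (le_of_eq ?_)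
    rw [ENNReal.mul_rpow_of_nonneg _ _ hqp, ← ENNReal.rpow_mul, ← ENNReal.rpow_mul, haq]
    congr 2 <;> field_simp
  calc (V ^ (-1 + a) * ∫⁻ y in B, h y * f y ∂ν) ^ q
      ≤ (V ^ (-1 + a) * (V * (N ^ (1 / σ) * A ^ (1 / s)))) ^ q := by gcongr
    _ = (V ^ a * (N ^ (1 / σ) * A ^ (1 / s))) ^ q := by
        have : V ^ (-1 + a) * V = V ^ a := by
          nth_rewrite 2 [← ENNReal.rpow_one V]
          rw [← ENNReal.rpow_add _ _ h0 h1, neg_add_cancel_comm]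
        rw [← mul_assoc, this]
    _ = V ^ (a * q) * (N ^ (q / σ) * (A ^ (p / s) * A ^ ((q - p) / s))) := by
        rw [ENNReal.mul_rpow_of_nonneg _ _ hq0.le, ENNReal.mul_rpow_of_nonneg _ _ hq0.le,
          ← ENNReal.rpow_mul, ← ENNReal.rpow_mul, ← ENNReal.rpow_mul,
          ← ENNReal.rpow_add_of_nonneg _ _ (by positivity) hqp]
        congr 3 <;> ring_nf
    _ ≤ V ^ (a * q) * (N ^ (q / σ) * (A ^ (p / s) *
          (V ^ (-(a * q)) * I ^ ((q - p) / p)))) := by gcongr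
    _ = (V ^ (a * q) * V ^ (-(a * q))) *
          (I ^ ((q - p) / p) * (N ^ (q / σ) * A ^ (p / s))) := by ring
    _ = _ := by
        rw [← ENNReal.rpow_add _ _ h0 h1, add_neg_cancel, ENNReal.rpow_zero, one_mul]

/-- The strong type `(p, q)` bound for the fractional maximal commutator, `1 / q = 1 / p - a`, when
the symbol has mean oscillations at most one. By Hölder's inequality on each ball it reduces to the
weighted maximal inequality for `f ^ s`, with the local oscillations of `b` as weights. -/
theorem exists_lintegral_iSup_commutator_rpow_le [Nontrivial E] {p q a : ℝ} (hp : 1 < p)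
    (hpq : p < q) (ha : q⁻¹ = p⁻¹ - a) :
    ∃ C : ℝ≥0, ∀ b : E → ℝ, Measurable b → LocallyIntegrable b μ →
      (∀ z R, 0 < R →
        ∫⁻ y in ball z R, ‖b y - ⨍ w in ball z R, b w ∂μ‖ₑ ∂μ ≤ μ (ball z R)) →
      ∀ f : E → ℝ≥0∞, Measurable f → ∫⁻ y, f y ^ p ∂μ ≠ ∞ →
        ∫⁻ x, (⨆ (t : ℝ) (_ : 0 < t), μ (ball x t) ^ (-1 + a) *
          ∫⁻ y in ball x t, ‖b x - b y‖ₑ * f y ∂μ) ^ q ∂μ ≤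
            C * (∫⁻ y, f y ^ p ∂μ) ^ (q / p) := by
  have hp0 : 0 < p := by linarith
  have hq0 : 0 < q := by linarith
  -- any exponent strictly between `1` and `p` would do
  set s := (1 + p) / 2 with hsdef
  have hs1 : 1 < s := by rw [hsdef]; linarith
  have hsp : s < p := by rw [hsdef]; linarith
  have hs0 : 0 < s := by linarith
  have hs := Real.HolderConjugate.conjExponent hs1
  set σ := s.conjExponent
  have hσ0 : 0 < σ := hs.symm.pos
  obtain ⟨K, hK⟩ := exists_oscillation_majorant μ hs.symm.lt.le (div_pos hq0 hσ0)
  obtain ⟨C, hC⟩ := exists_lintegral_iSup_weight_mul_average_rpow_le μ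
    ((one_lt_div hs0).2 hsp)
  refine ⟨C * K, fun b hbm hb hosc f hf hfin => ?_⟩
  set I := ∫⁻ y, f y ^ p ∂μ with hI
  have hIs : ∫⁻ y, (f y ^ s) ^ (p / s) ∂μ = I := by
    simp_rw [← ENNReal.rpow_mul, mul_div_cancel₀ p hs0.ne', hI]
  have hmain := hC (fun y => f y ^ s)
    (fun x t => ((μ (ball x t))⁻¹ * ∫⁻ y in ball x t, ‖b x - b y‖ₑ ^ σ ∂μ) ^ (q / σ)) K
    (hf.pow_const s) (by rw [hIs]; exact hfin) (hK b hbm hb hosc)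
  rw [hIs] at hmain
  have hqp : 0 ≤ (q - p) / p := div_nonneg (by linarith) hp0.le
  calc ∫⁻ x, (⨆ (t : ℝ) (_ : 0 < t), μ (ball x t) ^ (-1 + a) *
          ∫⁻ y in ball x t, ‖b x - b y‖ₑ * f y ∂μ) ^ q ∂μ
      ≤ ∫⁻ x, I ^ ((q - p) / p) * ⨆ (t : ℝ) (_ : 0 < t),
          ((μ (ball x t))⁻¹ * ∫⁻ y in ball x t, ‖b x - b y‖ₑ ^ σ ∂μ) ^ (q / σ) *
          ((μ (ball x t))⁻¹ * ∫⁻ y in ball x t, f y ^ s ∂μ) ^ (p / s) ∂μ := by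
        refine lintegral_mono fun x => ?_
        simp only [← ENNReal.orderIsoRpow_apply q hq0, OrderIso.map_iSup]
        refine iSup₂_le fun t ht => ?_
        rw [ENNReal.orderIsoRpow_apply]
        refine (rpow_measure_mul_setLIntegral_mul_rpow_le hs hsp hpq ha
          (measure_ball_pos μ x ht).ne' measure_ball_lt_top.ne
          (hbm.const_sub (b x)).enorm hf).trans ?_
        gcongr
        exact le_iSup₂ (f := fun (t : ℝ) (_ : 0 < t) =>
          ((μ (ball x t))⁻¹ * ∫⁻ y in ball x t, ‖b x - b y‖ₑ ^ σ ∂μ) ^ (q / σ) *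
          ((μ (ball x t))⁻¹ * ∫⁻ y in ball x t, f y ^ s ∂μ) ^ (p / s)) t ht
    _ ≤ I ^ ((q - p) / p) * (C * K * I) := by
        rw [lintegral_const_mul' _ _ (ENNReal.rpow_ne_top_of_nonneg hqp hfin)]
        gcongr
    _ = (C * K : ℝ≥0) * (I ^ ((q - p) / p) * I ^ (1 : ℝ)) := by
        rw [ENNReal.rpow_one]
        push_cast
        ring
    _ = _ := by
        rw [← ENNReal.rpow_add_of_nonneg _ _ hqp zero_le_one]
        congr 2
        field_simp
        ring

end Commutator

/-! ### Sufficiency: the strong type bound for symbols in BMO -/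

section Sufficiency

open Metric Module Filter Topology

variable {n : ℕ}

theorem setLIntegral_enorm_sub_le_bmoSeminorm (b : EuclideanSpace ℝ (Fin n) → ℝ)
    (z : EuclideanSpace ℝ (Fin n)) {R : ℝ} (hR : 0 < R) :
    ∫⁻ y in ball z R, ‖b y - ⨍ w in ball z R, b w‖ₑ ≤ bmoSeminorm b * volume (ball z R) := by
  have h : (volume (ball z R))⁻¹ * ∫⁻ y in ball z R, ‖b y - ⨍ w in ball z R, b w‖ₑ ≤
      bmoSeminorm b :=
    le_iSup_of_le z (le_iSup₂ (f := fun (r : ℝ) (_ : 0 < r) => (volume (ball z r))⁻¹ *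
      ∫⁻ y in ball z r, ‖b y - ⨍ w in ball z r, b w‖ₑ) R hR)
  rwa [← ENNReal.div_eq_inv_mul, ENNReal.div_le_iff_le_mul
    (Or.inl (measure_ball_pos volume z hR).ne') (Or.inl measure_ball_lt_top.ne)] at h

theorem bmoSeminorm_congr_ae {b b' : EuclideanSpace ℝ (Fin n) → ℝ} (h : b =ᵐ[volume] b') :
    bmoSeminorm b = bmoSeminorm b' := by
  unfold bmoSeminorm
  refine iSup_congr fun x => iSup_congr fun r => iSup_congr fun _ => ?_
  have h1 : ⨍ z in ball x r, b z = ⨍ z in ball x r, b' z :=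
    average_congr (ae_restrict_of_ae h)
  rw [h1]
  congr 1
  refine lintegral_congr_ae ?_
  filter_upwards [ae_restrict_of_ae h] with y hy
  rw [hy]

theorem fracMaxCommutator_congr_ae {b b' f f' : EuclideanSpace ℝ (Fin n) → ℝ} (α : ℝ)
    (hb : b =ᵐ[volume] b') (hf : f =ᵐ[volume] f') :
    fracMaxCommutator b α f =ᵐ[volume] fracMaxCommutator b' α f' := by
  filter_upwards [hb] with x hx
  unfold fracMaxCommutator
  refine iSup_congr fun t => iSup_congr fun _ => ?_
  congr 1
  refine lintegral_congr_ae ?_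
  filter_upwards [ae_restrict_of_ae hb, ae_restrict_of_ae hf] with y hy hy'
  rw [hx, hy, hy']

theorem measurable_fracMaxCommutator {b f : EuclideanSpace ℝ (Fin n) → ℝ} {α : ℝ}
    (hα : -1 + α / n ≤ 0) (hb : Measurable b) (hf : Measurable f) :
    Measurable (fracMaxCommutator b α f) := by
  refine measurable_iSup_rpow_measure_ball_mul_lintegral volume hα
    (k := fun x y => ‖b x - b y‖ₑ * ‖f y‖ₑ) ?_
  exact ((hb.comp measurable_fst).sub (hb.comp measurable_snd)).enorm.mul
    (hf.comp measurable_snd).enorm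

theorem fracMaxCommutator_const_mul (κ : ℝ) (b : EuclideanSpace ℝ (Fin n) → ℝ) (α : ℝ)
    (f : EuclideanSpace ℝ (Fin n) → ℝ) (x : EuclideanSpace ℝ (Fin n)) :
    fracMaxCommutator (fun y => κ * b y) α f x = ‖κ‖ₑ * fracMaxCommutator b α f x := by
  unfold fracMaxCommutator
  simp_rw [ENNReal.mul_iSup, ← mul_sub, enorm_mul, mul_assoc]
  refine iSup_congr fun t => iSup_congr fun _ => ?_
  rw [lintegral_const_mul' _ _ enorm_ne_top]
  ring

theorem setLIntegral_enorm_const_mul_sub_average {X : Type*} [MeasurableSpace X]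
    (μ : Measure X) (κ : ℝ) (b : X → ℝ) (s : Set X) :
    ∫⁻ y in s, ‖κ * b y - ⨍ w in s, κ * b w ∂μ‖ₑ ∂μ =
      ‖κ‖ₑ * ∫⁻ y in s, ‖b y - ⨍ w in s, b w ∂μ‖ₑ ∂μ := by
  have : ⨍ w in s, κ * b w ∂μ = κ * ⨍ w in s, b w ∂μ := by
    rw [setAverage_eq, setAverage_eq, integral_const_mul, smul_eq_mul, smul_eq_mul]
    ring
  simp_rw [this, ← mul_sub, enorm_mul]
  exact lintegral_const_mul' _ _ enorm_ne_top

/-- The bound `‖M_{b,α} f‖_q ≤ C ‖b‖_* ‖f‖_p`. The normalization divides by numbers slightly larger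
than `‖b‖_*`, so that a symbol of seminorm zero needs no separate treatment. -/
theorem exists_isLpLqBoundedWith_fracMaxCommutator (hn : n ≠ 0) {p q α : ℝ} (hp : 1 < p)
    (hpq : p < q) (hq : q⁻¹ = p⁻¹ - α / n) :
    ∃ C : ℝ≥0, ∀ b : EuclideanSpace ℝ (Fin n) → ℝ, IsBMO b →
      IsLpLqBoundedWith (fracMaxCommutator b α) (ENNReal.ofReal p) (ENNReal.ofReal q)
        (C * bmoSeminorm b) := by
  have : Nonempty (Fin n) := Fin.pos_iff_nonempty.1 (Nat.pos_of_ne_zero hn)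
  have hp0 : 0 < p := by linarith
  have hq0 : 0 < q := by linarith
  have hα : -1 + α / n ≤ 0 := by
    have h1 : p⁻¹ < 1 := inv_lt_one_of_one_lt₀ hp
    have h2 : 0 < q⁻¹ := inv_pos.2 hq0
    linarith
  obtain ⟨C, hC⟩ := exists_lintegral_iSup_commutator_rpow_le
    (volume : Measure (EuclideanSpace ℝ (Fin n))) hp hpq hq
  refine ⟨C ^ (1 / q), fun b hb f hf => ?_⟩
  set b₀ := hb.1.aestronglyMeasurable.mk b with hb₀
  have hbb : b =ᵐ[volume] b₀ := hb.1.aestronglyMeasurable.ae_eq_mk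
  have hbm : Measurable b₀ := hb.1.aestronglyMeasurable.stronglyMeasurable_mk.measurable
  set f₀ := hf.1.mk f
  have hff : f =ᵐ[volume] f₀ := hf.1.ae_eq_mk
  have hfm : Measurable f₀ := hf.1.stronglyMeasurable_mk.measurable
  have hT := fracMaxCommutator_congr_ae α hbb hff
  have hTm : Measurable (fracMaxCommutator b₀ α f₀) := measurable_fracMaxCommutator hα hbm hfm
  have hf₀ : MemLp f₀ (ENNReal.ofReal p) volume := (memLp_congr_ae hff).1 hf
  have hpO : ENNReal.ofReal p ≠ 0 := (ENNReal.ofReal_pos.2 hp0).ne'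
  have hqO : ENNReal.ofReal q ≠ 0 := (ENNReal.ofReal_pos.2 hq0).ne'
  have hI : eLpNorm f (ENNReal.ofReal p) volume =
      (∫⁻ y, ‖f₀ y‖ₑ ^ p) ^ (1 / p) := by
    rw [eLpNorm_congr_ae hff, eLpNorm_eq_lintegral_rpow_enorm_toReal hpO ENNReal.ofReal_ne_top,
      ENNReal.toReal_ofReal hp0.le]
  have hIfin : ∫⁻ y, ‖f₀ y‖ₑ ^ p ≠ ∞ := by
    have := hf.2.ne
    rw [hI] at this
    exact fun h => this (by rw [h, ENNReal.top_rpow_of_pos (by positivity)])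
  have hlocb : LocallyIntegrable b₀ volume := fun x =>
    let ⟨s, hs, hi⟩ := hb.1 x
    ⟨s, hs, hi.congr_fun_ae (ae_restrict_of_ae hbb)⟩
  -- the bound for every finite `κ` above the seminorm; dividing `b` by `κ` normalizes it
  have hκ : ∀ κ : ℝ≥0∞, bmoSeminorm b < κ → κ < ∞ →
      eLpNorm (fracMaxCommutator b α f) (ENNReal.ofReal q) volume ≤
        (C ^ (1 / q) : ℝ≥0) * κ * eLpNorm f (ENNReal.ofReal p) volume := by
    intro κ hκ1 hκ2
    lift κ to ℝ≥0 using hκ2.ne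
    have hκ0 : κ ≠ 0 := by
      rintro rfl
      simp at hκ1
    have hκe : ‖(κ : ℝ)‖ₑ = κ := by simp
    have hosc : ∀ z R, 0 < R → ∫⁻ y in ball z R,
        ‖(κ : ℝ)⁻¹ * b₀ y - ⨍ w in ball z R, (κ : ℝ)⁻¹ * b₀ w‖ₑ ≤ volume (ball z R) := by
      intro z R hR
      rw [setLIntegral_enorm_const_mul_sub_average, enorm_inv (by exact_mod_cast hκ0), hκe]
      calc (κ : ℝ≥0∞)⁻¹ * ∫⁻ y in ball z R, ‖b₀ y - ⨍ w in ball z R, b₀ w‖ₑ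
          ≤ (κ : ℝ≥0∞)⁻¹ * (κ * volume (ball z R)) := by
            gcongr
            refine (setLIntegral_enorm_sub_le_bmoSeminorm b₀ z hR).trans ?_
            rw [← bmoSeminorm_congr_ae hbb]
            gcongr
        _ = _ := by
            rw [← mul_assoc, ENNReal.inv_mul_cancel (by exact_mod_cast hκ0) ENNReal.coe_ne_top,
              one_mul]
    have hloc : LocallyIntegrable (fun y => (κ : ℝ)⁻¹ * b₀ y) volume := hlocb.smul (κ : ℝ)⁻¹
    have hmain := hC _ (hbm.const_mul (κ : ℝ)⁻¹) hloc hosc (fun y => ‖f₀ y‖ₑ) hfm.enorm hIfin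
    have hscale : ∀ x, fracMaxCommutator b₀ α f₀ x =
        κ * fracMaxCommutator (fun y => (κ : ℝ)⁻¹ * b₀ y) α f₀ x := by
      intro x
      rw [← hκe, ← fracMaxCommutator_const_mul]
      congr 1
      ext y
      rw [mul_inv_cancel_left₀ (by exact_mod_cast hκ0)]
    rw [eLpNorm_congr_ae hT, eLpNorm_eq_lintegral_rpow_enorm_toReal hqO ENNReal.ofReal_ne_top,
      ENNReal.toReal_ofReal hq0.le, hI]
    simp only [enorm_eq_self, hscale]
    have hq1 : (0 : ℝ) ≤ 1 / q := by positivity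
    calc (∫⁻ x, (κ * fracMaxCommutator (fun y => (κ : ℝ)⁻¹ * b₀ y) α f₀ x) ^ q) ^ (1 / q)
        = (κ ^ q * ∫⁻ x,
            fracMaxCommutator (fun y => (κ : ℝ)⁻¹ * b₀ y) α f₀ x ^ q) ^ (1 / q) := by
          simp_rw [ENNReal.mul_rpow_of_nonneg _ _ hq0.le]
          rw [lintegral_const_mul' _ _ (ENNReal.rpow_ne_top_of_nonneg hq0.le ENNReal.coe_ne_top)]
      _ ≤ (κ ^ q * (C * (∫⁻ y, ‖f₀ y‖ₑ ^ p) ^ (q / p))) ^ (1 / q) := by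
          gcongr
          exact hmain
      _ = _ := by
          rw [ENNReal.mul_rpow_of_nonneg _ _ hq1, ENNReal.mul_rpow_of_nonneg _ _ hq1,
            ← ENNReal.rpow_mul, ← ENNReal.rpow_mul, mul_one_div_cancel hq0.ne',
            ENNReal.rpow_one, ENNReal.coe_rpow_of_nonneg _ hq1, ← mul_assoc,
            mul_comm (κ : ℝ≥0∞)]
          congr 2
          field_simp
  have hfinal : eLpNorm (fracMaxCommutator b α f) (ENNReal.ofReal q) volume ≤
      (C ^ (1 / q) : ℝ≥0) * bmoSeminorm b * eLpNorm f (ENNReal.ofReal p) volume := by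
    have hne : (𝓝[>] bmoSeminorm b).NeBot := nhdsGT_neBot_of_exists_gt ⟨∞, hb.2⟩
    have hlim : Tendsto (fun κ : ℝ≥0∞ =>
        (C ^ (1 / q) : ℝ≥0) * eLpNorm f (ENNReal.ofReal p) volume * κ) (𝓝[>] bmoSeminorm b)
        (𝓝 ((C ^ (1 / q) : ℝ≥0) * eLpNorm f (ENNReal.ofReal p) volume * bmoSeminorm b)) :=
      (ENNReal.Tendsto.const_mul tendsto_id
        (Or.inr (ENNReal.mul_ne_top ENNReal.coe_ne_top hf.2.ne))).mono_left nhdsWithin_le_nhds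
    rw [mul_right_comm]
    refine ge_of_tendsto hlim ?_
    filter_upwards [Ioo_mem_nhdsGT hb.2] with κ hκI
    rw [mul_right_comm]
    exact hκ κ hκI.1 hκI.2
  refine ⟨⟨hTm.aestronglyMeasurable.congr hT.symm, hfinal.trans_lt ?_⟩, hfinal⟩
  exact ENNReal.mul_lt_top (ENNReal.mul_lt_top ENNReal.coe_lt_top hb.2) hf.2

end Sufficiency

/-! ### Necessity: the indicator of a half-space -/

section Necessity

open Metric Module

variable {n : ℕ}

theorem isBMO_indicator_one {s : Set (EuclideanSpace ℝ (Fin n))} (hs : MeasurableSet s) :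
    IsBMO (s.indicator fun _ => (1 : ℝ)) := by
  have hle : ∀ y, ‖s.indicator (fun _ => (1 : ℝ)) y‖ ≤ 1 := fun y =>
    (norm_indicator_le_norm_self _ _).trans (by simp)
  refine ⟨(locallyIntegrable_const (1 : ℝ)).indicator hs, lt_of_le_of_lt ?_
    (ENNReal.ofReal_lt_top (r := 2))⟩
  refine iSup_le fun x => iSup₂_le fun r hr => ?_
  have hB0 : volume (ball x r) ≠ 0 := (measure_ball_pos volume x hr).ne'
  have hB1 : volume (ball x r) ≠ ∞ := measure_ball_lt_top.ne
  have havg : ‖⨍ z in ball x r, s.indicator (fun _ => (1 : ℝ)) z‖ ≤ 1 := by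
    have h := norm_setIntegral_le_of_norm_le_const (μ := volume) (s := ball x r) (C := 1)
      measure_ball_lt_top fun y _ => hle y
    rw [setAverage_eq, norm_smul, norm_inv, Real.norm_of_nonneg measureReal_nonneg]
    rw [one_mul] at h
    exact inv_mul_le_one_of_le₀ h measureReal_nonneg
  calc _ ≤ (volume (ball x r))⁻¹ * ∫⁻ _ in ball x r, ENNReal.ofReal 2 := by
        gcongr with y
        rw [← ofReal_norm]
        refine ENNReal.ofReal_le_ofReal ((norm_sub_le _ _).trans ?_)
        linarith [hle y]
    _ = ENNReal.ofReal 2 := by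
        rw [setLIntegral_const, mul_left_comm, ENNReal.inv_mul_cancel hB0 hB1, mul_one]

/-- On the ball `B` of radius `r` about the origin, the commutator of the half-space indicator
applied to the indicator of `B` is at least a multiple of `|B| ^ (α / n)`: whichever side of the
hyperplane `x` is on, the other side of `B` contains a ball of radius `r / 2`. -/
theorem le_fracMaxCommutator_indicator_ball (i : Fin n) (α : ℝ) {r : ℝ} (hr : 0 < r)
    {x : EuclideanSpace ℝ (Fin n)} (hx : x ∈ ball (0 : EuclideanSpace ℝ (Fin n)) r) :
    (2 ^ n) ^ (-1 + α / n) * (ENNReal.ofReal 2⁻¹) ^ n *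
        volume (ball (0 : EuclideanSpace ℝ (Fin n)) r) ^ (α / n) ≤
      fracMaxCommutator ({y : EuclideanSpace ℝ (Fin n) | 0 < y i}.indicator fun _ => (1 : ℝ)) α
        ((ball 0 r).indicator fun _ => (1 : ℝ)) x := by
  set b : EuclideanSpace ℝ (Fin n) → ℝ := {y | 0 < y i}.indicator fun _ => (1 : ℝ) with hb
  set V := volume (ball (0 : EuclideanSpace ℝ (Fin n)) r) with hV
  have hV0 : V ≠ 0 := (measure_ball_pos volume _ hr).ne'
  have hV1 : V ≠ ∞ := measure_ball_lt_top.ne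
  have hr2 : 0 < 2 * r := by positivity
  have hvol2 : volume (ball x (2 * r)) = 2 ^ n * V := by
    rw [measure_ball_mul_radius volume x 0 two_pos, finrank_euclideanSpace_fin,
      ENNReal.ofReal_ofNat]
  have hcoord : ∀ y z : EuclideanSpace ℝ (Fin n), |y i - z i| ≤ dist y z := fun y z => by
    rw [dist_eq_norm, ← Real.norm_eq_abs]
    exact PiLp.norm_apply_le (y - z) i
  -- a ball of radius `r / 2` inside `B` on the other side of the hyperplane
  obtain ⟨z, hzB, hz⟩ : ∃ z : EuclideanSpace ℝ (Fin n), ball z (2⁻¹ * r) ⊆ ball 0 r ∧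
      ∀ y ∈ ball z (2⁻¹ * r), ‖b x - b y‖ₑ = 1 := by
    by_cases hxi : 0 < x i
    · refine ⟨EuclideanSpace.single i (-(2⁻¹ * r)), ball_subset_ball' ?_, fun y hy => ?_⟩
      · rw [dist_zero_right, PiLp.norm_single, norm_neg, Real.norm_of_nonneg
          (by positivity)]
        linarith
      · have h1 := (hcoord _ _).trans_lt (mem_ball.1 hy)
        simp only [PiLp.single_apply, if_true, abs_lt] at h1
        have hy0 : ¬ 0 < y i := by linarith [h1.2]
        simp [hb, hxi, hy0]
    · refine ⟨EuclideanSpace.single i (2⁻¹ * r), ball_subset_ball' ?_, fun y hy => ?_⟩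
      · rw [dist_zero_right, PiLp.norm_single, Real.norm_of_nonneg (by positivity)]
        linarith
      · have h1 := (hcoord _ _).trans_lt (mem_ball.1 hy)
        simp only [PiLp.single_apply, if_true, abs_lt] at h1
        have hy0 : 0 < y i := by linarith [h1.1]
        simp [hb, hxi, hy0]
  have hsub : ball z (2⁻¹ * r) ⊆ ball x (2 * r) := hzB.trans
    (ball_subset_ball' (by have := mem_ball'.1 hx; linarith))
  have hint : ENNReal.ofReal 2⁻¹ ^ n * V ≤ ∫⁻ y in ball x (2 * r),
      ‖b x - b y‖ₑ * ‖(ball 0 r).indicator (fun _ => (1 : ℝ)) y‖ₑ := by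
    calc ENNReal.ofReal 2⁻¹ ^ n * V = ∫⁻ _ in ball z (2⁻¹ * r), 1 := by
          rw [setLIntegral_const, one_mul, measure_ball_mul_radius volume z 0 (by norm_num),
            finrank_euclideanSpace_fin]
      _ ≤ ∫⁻ y in ball z (2⁻¹ * r),
            ‖b x - b y‖ₑ * ‖(ball 0 r).indicator (fun _ => (1 : ℝ)) y‖ₑ := by
          refine setLIntegral_mono' measurableSet_ball fun y hy => ?_
          rw [hz y hy, Set.indicator_of_mem (hzB hy)]
          simp
      _ ≤ _ := lintegral_mono_set hsub
  calc (2 ^ n) ^ (-1 + α / n) * (ENNReal.ofReal 2⁻¹) ^ n * V ^ (α / n)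
      = volume (ball x (2 * r)) ^ (-1 + α / n) * (ENNReal.ofReal 2⁻¹ ^ n * V) := by
        have : V ^ (-1 + α / n) * V = V ^ (α / n) := by
          nth_rewrite 2 [← ENNReal.rpow_one V]
          rw [← ENNReal.rpow_add _ _ hV0 hV1, neg_add_cancel_comm]
        rw [hvol2, ENNReal.mul_rpow_of_ne_top (by simp) hV1, ← this]
        ring
    _ ≤ volume (ball x (2 * r)) ^ (-1 + α / n) * ∫⁻ y in ball x (2 * r),
          ‖b x - b y‖ₑ * ‖(ball 0 r).indicator (fun _ => (1 : ℝ)) y‖ₑ := by gcongr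
    _ ≤ _ := le_iSup₂ (f := fun (t : ℝ) (_ : 0 < t) => volume (ball x t) ^ (-1 + α / n) *
          ∫⁻ y in ball x t, ‖b x - b y‖ₑ * ‖(ball 0 r).indicator (fun _ => (1 : ℝ)) y‖ₑ)
          (2 * r) hr2

/-- A power of `V` that is bounded on `(0, ∞)` is constant. -/
theorem eq_zero_of_forall_mul_rpow_le {c A δ : ℝ} (hc : 0 < c)
    (h : ∀ V : ℝ, 0 < V → c * V ^ δ ≤ A) : δ = 0 := by
  by_contra hδ
  have hA : 0 < A := (mul_pos hc (Real.rpow_pos_of_pos one_pos δ)).trans_le (h 1 one_pos)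
  have hpos : 0 < (A + 1) / c := by positivity
  have := h (((A + 1) / c) ^ (1 / δ)) (Real.rpow_pos_of_pos hpos _)
  rw [← Real.rpow_mul hpos.le, one_div_mul_cancel hδ, Real.rpow_one,
    mul_div_cancel₀ _ hc.ne'] at this
  linarith

/-- Boundedness for the indicator of a half-space alone forces the relation between the exponents:
tested on indicators of balls of volume `V`, it says that `V ^ (α / n + 1 / q - 1 / p)` stays bounded
for all `V > 0`. This includes the case `q = ∞`, where `1 / q = 0`. -/
theorem exponent_eq_of_isLpLqBounded (hn : n ≠ 0) {p α : ℝ} {q : ℝ≥0∞} (hp : 0 < p)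
    (hq : q ≠ 0)
    (h : ∀ b : EuclideanSpace ℝ (Fin n) → ℝ, IsBMO b →
      IsLpLqBounded (fracMaxCommutator b α) (ENNReal.ofReal p) q) :
    (q⁻¹).toReal = 1 / p - α / n := by
  have : Nonempty (Fin n) := Fin.pos_iff_nonempty.1 (Nat.pos_of_ne_zero hn)
  obtain ⟨i⟩ := this
  have hs : MeasurableSet {y : EuclideanSpace ℝ (Fin n) | 0 < y i} :=
    measurableSet_lt measurable_const (by fun_prop)
  obtain ⟨A, hA⟩ := h _ (isBMO_indicator_one hs)
  set c : ℝ≥0∞ := (2 ^ n) ^ (-1 + α / n) * (ENNReal.ofReal 2⁻¹) ^ n with hc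
  have hc0 : c ≠ 0 := by
    refine mul_ne_zero ?_ (by simp)
    exact (ENNReal.rpow_pos (by positivity) (by simp)).ne'
  have hc1 : c ≠ ∞ := ENNReal.mul_ne_top
    (ENNReal.rpow_ne_top_of_ne_zero (by simp) (by simp)) (by simp)
  have hball : ∀ r : ℝ, 0 < r →
      c * volume (ball (0 : EuclideanSpace ℝ (Fin n)) r) ^ (α / n) *
        volume (ball (0 : EuclideanSpace ℝ (Fin n)) r) ^ (q⁻¹).toReal ≤
      A * volume (ball (0 : EuclideanSpace ℝ (Fin n)) r) ^ (1 / p) := by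
    intro r hr
    set V := volume (ball (0 : EuclideanSpace ℝ (Fin n)) r)
    have hV0 : V ≠ 0 := (measure_ball_pos volume _ hr).ne'
    have hf : MemLp ((ball (0 : EuclideanSpace ℝ (Fin n)) r).indicator fun _ => (1 : ℝ))
        (ENNReal.ofReal p) volume :=
      memLp_indicator_const _ measurableSet_ball _ (Or.inr measure_ball_lt_top.ne)
    have hb := (hA _ hf).2
    rw [eLpNorm_indicator_const measurableSet_ball (ENNReal.ofReal_pos.2 hp).ne'
      ENNReal.ofReal_ne_top, ENNReal.toReal_ofReal hp.le, enorm_one, one_mul] at hb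
    refine le_trans ?_ hb
    have := eLpNorm_indicator_const' (μ := volume) (c := c * V ^ (α / n))
      (measurableSet_ball (x := (0 : EuclideanSpace ℝ (Fin n))) (ε := r)) hV0 hq
    rw [one_div, ← ENNReal.toReal_inv, enorm_eq_self] at this
    rw [← this]
    refine eLpNorm_mono_enorm fun x => ?_
    simp only [enorm_eq_self]
    refine Set.indicator_le (fun x hx => ?_) x
    exact le_fracMaxCommutator_indicator_ball i α hr hx
  have key := eq_zero_of_forall_mul_rpow_le (c := c.toReal) (A := A)
    (δ := α / n + (q⁻¹).toReal - 1 / p) (ENNReal.toReal_pos hc0 hc1) fun V hV => ?_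
  · linarith
  -- every positive number is the volume of a ball
  set v := volume (ball (0 : EuclideanSpace ℝ (Fin n)) 1) with hv
  have hv0 : v ≠ 0 := (measure_ball_pos volume _ one_pos).ne'
  have hv1 : v ≠ ∞ := measure_ball_lt_top.ne
  have hvpos : 0 < v.toReal := ENNReal.toReal_pos hv0 hv1
  set r : ℝ := (V / v.toReal) ^ (1 / (n : ℝ)) with hr
  have hrpos : 0 < r := Real.rpow_pos_of_pos (by positivity) _
  have hvol : volume (ball (0 : EuclideanSpace ℝ (Fin n)) r) = ENNReal.ofReal V := by
    rw [Measure.addHaar_ball_of_pos _ _ hrpos, finrank_euclideanSpace_fin, ← hv, hr,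
      ← Real.rpow_natCast, ← Real.rpow_mul (by positivity),
      one_div_mul_cancel (by exact_mod_cast hn), Real.rpow_one]
    nth_rewrite 2 [← ENNReal.ofReal_toReal hv1]
    rw [← ENNReal.ofReal_mul (by positivity), div_mul_cancel₀ _ hvpos.ne']
  have h1 := hball r hrpos
  rw [hvol] at h1
  have h2 := ENNReal.toReal_mono (ENNReal.mul_ne_top ENNReal.coe_ne_top
    (ENNReal.rpow_ne_top_of_nonneg (by positivity) ENNReal.ofReal_ne_top)) h1
  simp only [ENNReal.toReal_mul, ← ENNReal.toReal_rpow, ENNReal.toReal_ofReal hV.le,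
    ENNReal.coe_toReal] at h2
  have hVp := Real.rpow_pos_of_pos hV (1 / p)
  rw [Real.rpow_sub hV, Real.rpow_add hV, ← mul_div_assoc, div_le_iff₀ hVp, ← mul_assoc]
  exact h2

end Necessity

/-! ### The equivalence -/

theorem mainTheorem7 (n : ℕ) (p α : ℝ) (q : ℝ≥0∞) (hp : 1 < p) (hα : 0 < α)
    (hαp : α < (n : ℝ) / p) (hq : 0 < q) :
    ((∀ b : EuclideanSpace ℝ (Fin n) → ℝ, IsBMO b →
        IsLpLqBounded (fracMaxCommutator b α) (ENNReal.ofReal p) q) ↔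
      (q⁻¹).toReal = 1 / p - α / (n : ℝ)) ∧
    ((∃ C : ℝ≥0, ∀ b : EuclideanSpace ℝ (Fin n) → ℝ, IsBMO b →
        IsLpLqBoundedWith (fracMaxCommutator b α) (ENNReal.ofReal p) q (C * bmoSeminorm b)) ↔
      (q⁻¹).toReal = 1 / p - α / (n : ℝ)) := by
  have hp0 : 0 < p := by linarith
  have hn : n ≠ 0 := by
    rintro rfl
    simp only [Nat.cast_zero, zero_div] at hαp
    linarith
  have hn0 : (0 : ℝ) < n := by exact_mod_cast Nat.pos_of_ne_zero hn
  have hαn : 0 < α / n := by positivity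
  have hbdd : (∃ C : ℝ≥0, ∀ b : EuclideanSpace ℝ (Fin n) → ℝ, IsBMO b →
        IsLpLqBoundedWith (fracMaxCommutator b α) (ENNReal.ofReal p) q (C * bmoSeminorm b)) →
      ∀ b : EuclideanSpace ℝ (Fin n) → ℝ, IsBMO b →
        IsLpLqBounded (fracMaxCommutator b α) (ENNReal.ofReal p) q := by
    rintro ⟨C, hC⟩ b hb
    refine ⟨C * (bmoSeminorm b).toNNReal, ?_⟩
    rw [ENNReal.coe_mul, ENNReal.coe_toNNReal hb.2.ne]
    exact hC b hb
  have hsuff : (q⁻¹).toReal = 1 / p - α / (n : ℝ) →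
      ∃ C : ℝ≥0, ∀ b : EuclideanSpace ℝ (Fin n) → ℝ, IsBMO b →
        IsLpLqBoundedWith (fracMaxCommutator b α) (ENNReal.ofReal p) q
          (C * bmoSeminorm b) := by
    intro h
    have hpos : 0 < 1 / p - α / n := by
      rw [sub_pos, div_lt_div_iff₀ hn0 hp0]
      rw [lt_div_iff₀ hp0] at hαp
      linarith
    -- the exponent `q = ∞` is excluded by `α < n / p`
    have hqtop : q ≠ ∞ := by
      rintro rfl
      simp only [ENNReal.inv_top, ENNReal.toReal_zero] at h
      linarith
    rw [ENNReal.toReal_inv] at h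
    have hqpos : 0 < q.toReal := ENNReal.toReal_pos hq.ne' hqtop
    have hpq : p < q.toReal := by
      rw [← inv_lt_inv₀ hqpos hp0, h, one_div]
      linarith
    have := exists_isLpLqBoundedWith_fracMaxCommutator hn hp hpq (by rw [h, one_div])
    rwa [ENNReal.ofReal_toReal hqtop] at this
  have hnec := exponent_eq_of_isLpLqBounded (α := α) hn hp0 hq.ne'
  exact ⟨⟨hnec, fun h => hbdd (hsuff h)⟩, ⟨fun h => hnec (hbdd h), hsuff⟩⟩
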